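/- A \emph{literal} is a propositional variable or its negation; a \emph{clause} is a finite set of literals, read as their disjunction; a \emph{CNF formula} is a finite set of clauses, read as their conjunction. A CNF formula is a \emph{Krom formula} (2-CNF formula) if each of its clauses contains at most two literals. The \emph{implication problem for Krom formulas}, $\mathrm{IMP}(\mathrm{Krom})$, is the following decision problem: given (encoded as a word over a finite alphabet) a finite set $\Phi$ of Krom formulas and a Krom formula $\psi$, decide whether $\Phi \models \psi$, that is, whether every truth assignment that satisfies all formulas in $\Phi$ also satisfies $\psi$. \textbf{Lemma.} $\mathrm{IMP}(\mathrm{Krom}) \in \mathrm{P}$; that is, the set of encodings of the pairs $(\Phi,\psi)$ of this form with $\Phi \models \psi$ is decided by a deterministic Turing machine in time polynomial in the length of the input word. -/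

import Mathlib

namespace KromImp

/-! ### Propositional logic: CNF formulas as finite sets of clauses -/

/-- Propositional variables, identified with their names; names are binary words, so there is a
countably infinite supply of variables. -/
abbrev PVar := List Bool

/-- A literal is a variable (`positive = true`) or a negated variable (`positive = false`). -/
structure Literal where
  var : PVar
  positive : Bool
deriving DecidableEq

/-- A clause is a finite set of literals, read as their disjunction. -/
abbrev Clause := Finset Literal

/-- A CNF formula is a finite set of clauses, read as their conjunction. -/
abbrev CNF := Finset Clause

/-- A truth assignment. Only the values on the variables that occur in a formula matter. -/
abbrev Assignment := PVar → Bool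

/-- The truth value of a literal. -/
def Literal.eval (θ : Assignment) (ℓ : Literal) : Bool :=
  if ℓ.positive then θ ℓ.var else !(θ ℓ.var)

/-- `θ` satisfies at least one literal of the clause (so the empty clause is false). -/
def Clause.SatisfiedBy (C : Clause) (θ : Assignment) : Prop :=
  ∃ ℓ ∈ C, ℓ.eval θ = true

/-- `θ` satisfies every clause of the formula (so the empty formula is true). -/
def CNF.SatisfiedBy (φ : CNF) (θ : Assignment) : Prop :=
  ∀ C ∈ φ, Clause.SatisfiedBy C θ

/-- `Φ ⊨ ψ`: every assignment that satisfies all formulas of `Φ` satisfies `ψ`. -/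
def Entails (Φ : Finset CNF) (ψ : CNF) : Prop :=
  ∀ θ : Assignment, (∀ φ ∈ Φ, CNF.SatisfiedBy φ θ) → CNF.SatisfiedBy ψ θ

/-- The class of Krom (2-CNF) formulas: every clause contains at most two literals. -/
def krom : Set CNF := {φ | ∀ C ∈ φ, C.card ≤ 2}

/-! ### Encoding of instances as words over a finite alphabet -/

/-- The input alphabet. -/
inductive Symbol
  | bit (b : Bool)
  | pos
  | neg
  | endClause
  | endFormula
  | turnstile
deriving DecidableEq, Fintype

/-- A literal is written as the name of its variable followed by its sign. -/
def encodeLiteral (ℓ : Literal) : List Symbol :=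
  ℓ.var.map Symbol.bit ++ [if ℓ.positive then Symbol.pos else Symbol.neg]

/-- A clause is written by listing its literals, followed by an end marker. -/
def encodeClause (c : List Literal) : List Symbol :=
  c.flatMap encodeLiteral ++ [Symbol.endClause]

/-- A formula is written by listing its clauses, followed by an end marker. -/
def encodeFormula (f : List (List Literal)) : List Symbol :=
  f.flatMap encodeClause ++ [Symbol.endFormula]

/-- An instance is written by listing the premises, then a turnstile, then the conclusion. -/
def encodeInstance (p : List (List (List Literal))) (f : List (List Literal)) : List Symbol :=
  p.flatMap encodeFormula ++ [Symbol.turnstile] ++ encodeFormula f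

/-- The CNF formula whose clauses, and their literals, are enumerated by the list `f`
(in any order, possibly with repetitions). -/
def toCNF (f : List (List Literal)) : CNF :=
  (f.map List.toFinset).toFinset

/-- The set of CNF formulas enumerated by the list `p`. -/
def toPremises (p : List (List (List Literal))) : Finset CNF :=
  (p.map toCNF).toFinset

/-- The word `w` is an encoding of the instance `(Φ, ψ)`. -/
def IsEncoding (w : List Symbol) (Φ : Finset CNF) (ψ : CNF) : Prop :=
  ∃ p f, toPremises p = Φ ∧ toCNF f = ψ ∧ encodeInstance p f = w

/-- The implication problem for a class `F` of CNF formulas, as a formal language: the encodings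
of all pairs `(Φ, ψ)` with `Φ` a finite set of formulas from `F`, `ψ ∈ F`, and `Φ ⊨ ψ`. -/
def IMP (F : Set CNF) : Language Symbol :=
  {w | ∃ (Φ : Finset CNF) (ψ : CNF), IsEncoding w Φ ψ ∧ (Φ : Set CNF) ⊆ F ∧ ψ ∈ F ∧ Entails Φ ψ}

/-! ### The encoding is uniquely readable -/

theorem flatMap_end_inj {α : Type} (e : α → List Symbol) (t : Symbol)
    (he : ∀ a b r s, e a ++ r = e b ++ s → a = b ∧ r = s)
    (ht : ∀ a r s, e a ++ r ≠ t :: s) :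
    ∀ (l m : List α) (r s : List Symbol),
      l.flatMap e ++ [t] ++ r = m.flatMap e ++ [t] ++ s → l = m ∧ r = s := by
  intro l
  induction l with
  | nil =>
    intro m r s h
    cases m with
    | nil => simpa using h
    | cons b m =>
      simp only [List.flatMap_nil, List.flatMap_cons, List.nil_append, List.append_assoc,
        List.cons_append] at h
      exact absurd h.symm (ht _ _ _)
  | cons a l ih =>
    intro m r s h
    cases m with
    | nil =>
      simp only [List.flatMap_nil, List.flatMap_cons, List.nil_append, List.append_assoc,
        List.cons_append] at h
      exact absurd h (ht _ _ _)
    | cons b m =>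
      simp only [List.flatMap_cons, List.append_assoc] at h
      obtain ⟨rfl, h'⟩ := he _ _ _ _ h
      obtain ⟨rfl, rfl⟩ := ih m r s (by simpa using h')
      exact ⟨rfl, rfl⟩

theorem encodeLiteral_inj (a b : Literal) (r s : List Symbol)
    (h : encodeLiteral a ++ r = encodeLiteral b ++ s) : a = b ∧ r = s := by
  obtain ⟨v, p⟩ := a
  obtain ⟨w, q⟩ := b
  have key : ∀ v w : List Bool, encodeLiteral ⟨v, p⟩ ++ r = encodeLiteral ⟨w, q⟩ ++ s →
      v = w ∧ p = q ∧ r = s := by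
    intro v
    induction v with
    | nil =>
      intro w h
      cases w <;> cases p <;> cases q <;> simp_all [encodeLiteral]
    | cons x v ih =>
      intro w h
      cases w with
      | nil => cases p <;> cases q <;> simp_all [encodeLiteral]
      | cons y w =>
        simp only [encodeLiteral, List.map_cons, List.cons_append, List.cons.injEq,
          Symbol.bit.injEq] at h
        obtain ⟨rfl, h3⟩ := ih w h.2
        exact ⟨by rw [h.1], h3⟩
  obtain ⟨rfl, rfl, rfl⟩ := key v w h
  exact ⟨rfl, rfl⟩

theorem encodeClause_inj (a b : List Literal) (r s : List Symbol)
    (h : encodeClause a ++ r = encodeClause b ++ s) : a = b ∧ r = s := by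
  refine flatMap_end_inj encodeLiteral Symbol.endClause encodeLiteral_inj ?_ a b r s h
  rintro ⟨_ | _, _ | _⟩ r s <;> simp [encodeLiteral]

theorem encodeFormula_inj (a b : List (List Literal)) (r s : List Symbol)
    (h : encodeFormula a ++ r = encodeFormula b ++ s) : a = b ∧ r = s := by
  refine flatMap_end_inj encodeClause Symbol.endFormula encodeClause_inj ?_ a b r s h
  rintro (_ | ⟨⟨_ | _, _ | _⟩, _⟩) r s <;> simp [encodeClause, encodeLiteral]

theorem encodeInstance_inj {p q : List (List (List Literal))} {f g : List (List Literal)}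
    (h : encodeInstance p f = encodeInstance q g) : p = q ∧ f = g := by
  obtain ⟨h1, h2⟩ :=
    flatMap_end_inj encodeFormula Symbol.turnstile encodeFormula_inj
      (by rintro (_ | ⟨_ | ⟨⟨_ | _, _ | _⟩, _⟩, _⟩) r s <;>
            simp [encodeFormula, encodeClause, encodeLiteral]) p q _ _ h
  exact ⟨h1, (encodeFormula_inj f g [] [] (by simpa using h2)).1⟩

/-- A word encodes at most one instance. -/
theorem IsEncoding.unique {w : List Symbol} {Φ Φ' : Finset CNF} {ψ ψ' : CNF}
    (h : IsEncoding w Φ ψ) (h' : IsEncoding w Φ' ψ') : Φ = Φ' ∧ ψ = ψ' := by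
  obtain ⟨p, f, rfl, rfl, hw⟩ := h
  obtain ⟨q, g, rfl, rfl, hw'⟩ := h'
  obtain ⟨rfl, rfl⟩ := encodeInstance_inj (hw.trans hw'.symm)
  exact ⟨rfl, rfl⟩

/-! ### The class P -/

open Classical in
/-- The class P: the language `L` over the finite alphabet `Γ` is decided by a (multi-stack)
Turing machine that on every word `w` over `Γ` halts after at most polynomially many steps in the
length of `w`, with output `true` if `w ∈ L` and `false` otherwise. -/
def InP {Γ : Type} [Fintype Γ] (L : Language Γ) : Prop :=
  Nonempty (Turing.TM2ComputableInPolyTime (id : List Γ → List Γ) Computability.encodeBool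
    (fun w : List Γ => decide (w ∈ L)))

end KromImp

namespace KromImp

open Turing

/-! ### Structured programs over stacks -/

/-! Two facts carry the theorem: implication between Krom formulas reduces to reachability in a
graph on literals, and everything involved can be written in a small language of polynomial-time
programs that compiles to Turing machines.

For the logic, `Φ ⊨ ψ` holds iff for each clause of `ψ` the premises together with the negated
literals of that clause, taken as unit clauses, are unsatisfiable. These clauses are again Krom, and
a clause `{a, b}` amounts to the edges `¬a → b` and `¬b → a`. If no clause is empty,
unsatisfiability means that some literal and its complement reach each other: such a cycle defeats
every assignment, and otherwise a maximal consistent set of literals closed under reachability is a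
satisfying assignment (`exists_assignment`, `unsat_iff`). Reachability is computed in the manner of
Warshall, admitting one intermediate literal after another (`mem_foldl_connect`,
`mem_implications`).

For the running time, data are binary trees whose preorder codes lie on one stack. `PolyTime` bounds
both the time and the output size, hence is closed under composition; it is closed under pairing,
case distinction and those folds whose accumulator grows by an amount independent of its current
size (`PolyTime.foldl`). The decision procedure is assembled from these. A right-to-left parser
(`decideParsed_iff`) supplies its input and rejects malformed words, and `Exec.steps` carries the
time bounds over to the compiled machine. -/

/-- Structured programs over a family of stacks: `case k f` pops stack `k` and continues according
to the symbol found, and `loop k f` pops stack `k` until it is empty, running `f a` on every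
symbol `a` popped. -/
inductive Prog {K : Type} (Γ : K → Type) : Type
  | skip : Prog Γ
  | push (k : K) (a : Γ k) : Prog Γ
  | case (k : K) (f : Option (Γ k) → Prog Γ) : Prog Γ
  | seq (c d : Prog Γ) : Prog Γ
  | loop (k : K) (f : Γ k → Prog Γ) : Prog Γ

namespace Prog

variable {K : Type} {Γ : K → Type}

/-- The labels of the Turing machine code of a program. -/
def Label : Prog Γ → Type
  | skip => Unit
  | push _ _ => Unit
  | case k f => Option (Σ a : Option (Γ k), Label (f a))
  | seq c d => Label c ⊕ Label d
  | loop k f => Option (Σ a : Γ k, Label (f a))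

/-- The entry label of a program. -/
def start : (c : Prog Γ) → Label c
  | skip => ()
  | push _ _ => ()
  | case _ _ => none
  | seq c _ => Sum.inl (start c)
  | loop _ _ => none

theorem finite_label [∀ k, Finite (Γ k)] (c : Prog Γ) : Finite (Label c) := by
  induction c with
  | skip => exact inferInstanceAs (Finite Unit)
  | push _ _ => exact inferInstanceAs (Finite Unit)
  | case k f ih =>
    have := ih
    exact inferInstanceAs (Finite (Option (Σ a : Option (Γ k), Label (f a))))
  | seq c d ihc ihd => exact inferInstanceAs (Finite (Label c ⊕ Label d))
  | loop k f ih =>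
    have := ih
    exact inferInstanceAs (Finite (Option (Σ a : Γ k, Label (f a))))

variable [DecidableEq K]

/-- Big-step semantics: `Exec c S S' t` means that `c` turns `S` into `S'` in `t` machine steps. -/
inductive Exec : Prog Γ → (∀ k, List (Γ k)) → (∀ k, List (Γ k)) → ℕ → Prop
  | skip (S) : Exec skip S S 1
  | push (S k a) : Exec (push k a) S (Function.update S k (a :: S k)) 1
  | case {S S' k f t} : Exec (f (S k).head?) (Function.update S k (S k).tail) S' t →
      Exec (case k f) S S' (t + 1)
  | seq {S S' S'' c d t t'} : Exec c S S' t → Exec d S' S'' t' → Exec (seq c d) S S'' (t + t')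
  | loop_nil {S k} {f : Γ k → Prog Γ} : S k = [] → Exec (loop k f) S S 1
  | loop_cons {S S' S'' k a l t t'} {f : Γ k → Prog Γ} : S k = a :: l →
      Exec (f a) (Function.update S k l) S' t → Exec (loop k f) S' S'' t' →
      Exec (loop k f) S S'' (t + t' + 1)

/-- The Turing machine code of a program whose labels are embedded by `e`, with exit label `x`.
The internal state of the machine stores the symbol popped last from each stack. -/
def code : (c : Prog Γ) → {L : Type} → (Label c → L) → L → Label c →
    TM2.Stmt Γ L (∀ k, Option (Γ k))
  | skip, _, _, x, _ => .goto fun _ => x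
  | push k a, _, _, x, _ => .push k (fun _ => a) (.goto fun _ => x)
  | case k f, _, e, _, none =>
    .pop k (fun v a => Function.update v k a) (.goto fun v => e (some ⟨v k, start (f (v k))⟩))
  | case _ f, _, e, x, some ⟨a, l⟩ => code (f a) (fun l => e (some ⟨a, l⟩)) x l
  | seq c d, _, e, _, Sum.inl l => code c (fun l => e (Sum.inl l)) (e (Sum.inr (start d))) l
  | seq _ d, _, e, x, Sum.inr l => code d (fun l => e (Sum.inr l)) x l
  | loop k f, _, e, x, none =>
    .pop k (fun v a => Function.update v k a)
      (.goto fun v => (v k).elim x fun a => e (some ⟨a, start (f a)⟩))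
  | loop _ f, _, e, _, some ⟨a, l⟩ => code (f a) (fun l => e (some ⟨a, l⟩)) (e none) l

/-! ### Simulation of program execution by the machine -/

/-- `n` steps of the machine `M` lead from `a` to `b`. -/
def Steps {L σ : Type} (M : L → TM2.Stmt Γ L σ) (n : ℕ) (a b : TM2.Cfg Γ L σ) : Prop :=
  (flip bind (TM2.step M))^[n] (some a) = some b

theorem Steps.trans {L σ : Type} {M : L → TM2.Stmt Γ L σ} {m n : ℕ} {a b c : TM2.Cfg Γ L σ}
    (h : Steps M m a b) (h' : Steps M n b c) : Steps M (m + n) a c := by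
  unfold Steps at *
  rw [Nat.add_comm, Function.iterate_add_apply, h, h']

theorem Steps.single {L σ : Type} {M : L → TM2.Stmt Γ L σ} (l : L) (v : σ) (S : ∀ k, List (Γ k)) :
    Steps M 1 ⟨some l, v, S⟩ (TM2.stepAux (M l) v S) := rfl

/-- The code of a subprogram sits inside that of its parent under a larger embedding and with
another exit label, so the induction needs `M`, `e` and `x` arbitrary. The initial internal state is
arbitrary and the final one unspecified, because code reads a popped symbol only right after the pop
that stored it. -/
theorem Exec.steps {c : Prog Γ} {S S' : ∀ k, List (Γ k)} {t : ℕ} (h : Exec c S S' t) :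
    ∀ {L : Type} (M : L → TM2.Stmt Γ L (∀ k, Option (Γ k))) (e : Label c → L) (x : L),
      (∀ l, M (e l) = code c e x l) → ∀ v, ∃ v',
        Steps M t ⟨some (e (start c)), v, S⟩ ⟨some x, v', S'⟩ := by
  induction h with
  | skip S =>
    intro L M e x hM v
    refine ⟨v, ?_⟩
    have := Steps.single (M := M) (e (start Prog.skip)) v S
    rwa [hM, code] at this
  | push S k a =>
    intro L M e x hM v
    refine ⟨v, ?_⟩
    have := Steps.single (M := M) (e (start (Prog.push k a))) v S
    rwa [hM, code] at this
  | @case S S' k f t _ ih =>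
    intro L M e x hM v
    obtain ⟨v', h'⟩ := ih M (fun l => e (some ⟨_, l⟩)) x (fun l => hM (some ⟨_, l⟩))
      (Function.update v k (S k).head?)
    refine ⟨v', ?_⟩
    have := Steps.single (M := M) (e (start (Prog.case k f))) v S
    rw [hM, start, code] at this
    simp only [TM2.stepAux] at this
    -- The type of the second component of the label depends on the popped symbol, so the symbol is
    -- generalized before it is replaced.
    have key : ∀ o, o = (S k).head? →
        e (some ⟨o, start (f o)⟩) = e (some ⟨(S k).head?, start (f (S k).head?)⟩) := by
      rintro _ rfl
      rfl
    rw [key _ (Function.update_self (β := fun k => Option (Γ k)) k _ v)] at this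
    rw [Nat.add_comm]
    exact this.trans h'
  | @seq S S' S'' c d t t' _ _ ih ih' =>
    intro L M e x hM v
    obtain ⟨v', h'⟩ := ih M (fun l => e (Sum.inl l)) (e (Sum.inr (start d)))
      (fun l => hM (Sum.inl l)) v
    obtain ⟨v'', h''⟩ := ih' M (fun l => e (Sum.inr l)) x (fun l => hM (Sum.inr l)) v'
    exact ⟨v'', h'.trans h''⟩
  | @loop_nil S k f hS =>
    intro L M e x hM v
    refine ⟨Function.update v k none, ?_⟩
    have := Steps.single (M := M) (e (start (Prog.loop k f))) v S
    rw [hM, start, code] at this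
    simp only [TM2.stepAux, Function.update_self, hS, List.head?_nil, List.tail_nil,
      Option.elim_none] at this
    rwa [← hS, Function.update_eq_self] at this
  | @loop_cons S S' S'' k a l t t' f hS _ _ ih ih' =>
    intro L M e x hM v
    obtain ⟨v', h'⟩ := ih M (fun l => e (some ⟨_, l⟩)) (e none) (fun l => hM (some ⟨_, l⟩))
      (Function.update v k (some a))
    obtain ⟨v'', h''⟩ := ih' M e x hM v'
    refine ⟨v'', ?_⟩
    have := Steps.single (M := M) (e (start (Prog.loop k f))) v S
    rw [hM, start, code] at this
    simp only [TM2.stepAux, Function.update_self, hS, List.head?_cons, List.tail_cons,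
      Option.elim_some] at this
    rw [Nat.add_comm]
    exact this.trans (h'.trans h'')

/-- The Turing machine that runs a program, with input stack `k₀` and output stack `k₁`. -/
noncomputable def toFinTM2 [Fintype K] [∀ k, Fintype (Γ k)] (c : Prog Γ) (k₀ k₁ : K) : FinTM2 :=
  haveI := finite_label c
  { K := K
    k₀ := k₀
    k₁ := k₁
    Γ := Γ
    Λ := Option (Label c)
    main := some (start c)
    ΛFin := Fintype.ofFinite _
    σ := ∀ k, Option (Γ k)
    initialState := fun _ => none
    -- The extra label `none` is the common exit. It resets the internal state, since a halting
    -- configuration must carry the initial one; this costs the additional step in the time bound.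
    m := fun l => l.elim (.load (fun _ _ => none) .halt) (code c some none) }

theorem Exec.steps_toFinTM2 [Fintype K] [∀ k, Fintype (Γ k)] {c : Prog Γ} {k₀ k₁ : K}
    {S S' : ∀ k, List (Γ k)} {t : ℕ} (h : Exec c S S' t) :
    (flip bind (c.toFinTM2 k₀ k₁).step)^[t + 1]
        (some (⟨some (some (start c)), fun _ => none, S⟩ : (c.toFinTM2 k₀ k₁).Cfg)) =
      some (⟨none, fun _ => none, S'⟩ : (c.toFinTM2 k₀ k₁).Cfg) := by
  obtain ⟨v', h'⟩ := h.steps (c.toFinTM2 k₀ k₁).m some none (fun l => rfl) (fun _ => none)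
  exact h'.trans (Steps.single _ _ _)

end Prog

end KromImp

namespace KromImp

/-! ### Binary trees on stacks -/

/-- The work stacks: `main` holds the data, the others are empty between operations. -/
inductive Work
  | main | aux | tmp | cnt
deriving DecidableEq

instance : Fintype Work := ⟨{.main, .aux, .tmp, .cnt}, by rintro (_ | _ | _ | _) <;> decide⟩

/-- The contents of the decision procedure: the input, the reversed input, the output, and the
work stacks. -/
inductive Stk
  | inp | rev | out
  | work (k : Work)
deriving DecidableEq, Fintype

/-- The stack alphabets. -/
abbrev StkSym : Stk → Type
  | .inp => Symbol
  | .rev => Symbol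
  | .out => Bool
  | .work _ => Bool

instance (k : Stk) : Fintype (StkSym k) := by
  cases k <;> dsimp only [StkSym] <;> infer_instance

/-- The stack contents given by lists. -/
def contents (i v : List Symbol) (o m x z c : List Bool) : ∀ k, List (StkSym k)
  | .inp => i
  | .rev => v
  | .out => o
  | .work .main => m
  | .work .aux => x
  | .work .tmp => z
  | .work .cnt => c

section contents

variable (i v : List Symbol) (o m x z c : List Bool)

@[simp] theorem contents_inp : contents i v o m x z c .inp = i := rfl
@[simp] theorem contents_rev : contents i v o m x z c .rev = v := rfl
@[simp] theorem contents_out : contents i v o m x z c .out = o := rfl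
@[simp] theorem contents_main : contents i v o m x z c (.work .main) = m := rfl
@[simp] theorem contents_aux : contents i v o m x z c (.work .aux) = x := rfl
@[simp] theorem contents_tmp : contents i v o m x z c (.work .tmp) = z := rfl
@[simp] theorem contents_cnt : contents i v o m x z c (.work .cnt) = c := rfl

@[simp] theorem update_contents_inp (l : List Symbol) :
    Function.update (contents i v o m x z c) .inp l = contents l v o m x z c := by
  funext k; rcases k with _ | _ | _ | ⟨_ | _ | _ | _⟩ <;> rfl

@[simp] theorem update_contents_rev (l : List Symbol) :
    Function.update (contents i v o m x z c) .rev l = contents i l o m x z c := by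
  funext k; rcases k with _ | _ | _ | ⟨_ | _ | _ | _⟩ <;> rfl

@[simp] theorem update_contents_out (l : List Bool) :
    Function.update (contents i v o m x z c) .out l = contents i v l m x z c := by
  funext k; rcases k with _ | _ | _ | ⟨_ | _ | _ | _⟩ <;> rfl

@[simp] theorem update_contents_main (l : List Bool) :
    Function.update (contents i v o m x z c) (.work .main) l = contents i v o l x z c := by
  funext k; rcases k with _ | _ | _ | ⟨_ | _ | _ | _⟩ <;> rfl

@[simp] theorem update_contents_aux (l : List Bool) :
    Function.update (contents i v o m x z c) (.work .aux) l = contents i v o m l z c := by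
  funext k; rcases k with _ | _ | _ | ⟨_ | _ | _ | _⟩ <;> rfl

@[simp] theorem update_contents_tmp (l : List Bool) :
    Function.update (contents i v o m x z c) (.work .tmp) l = contents i v o m x l c := by
  funext k; rcases k with _ | _ | _ | ⟨_ | _ | _ | _⟩ <;> rfl

@[simp] theorem update_contents_cnt (l : List Bool) :
    Function.update (contents i v o m x z c) (.work .cnt) l = contents i v o m x z l := by
  funext k; rcases k with _ | _ | _ | ⟨_ | _ | _ | _⟩ <;> rfl

end contents

/-- Binary trees. -/
inductive BTree
  | leaf
  | node (l r : BTree)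

/-- The preorder code of a binary tree. -/
def BTree.code : BTree → List Bool
  | leaf => [false]
  | node l r => true :: (l.code ++ r.code)

theorem BTree.length_code_pos (t : BTree) : 1 ≤ t.code.length := by
  cases t <;> simp [BTree.code]

/-- Programs over the stacks of the decision procedure. -/
abbrev StkProg : Type := Prog StkSym

/-- The program `c` turns `S` into `S'` in at most `n` machine steps. -/
def Runs (c : StkProg) (S S' : ∀ k, List (StkSym k)) (n : ℕ) : Prop :=
  ∃ t ≤ n, Prog.Exec c S S' t

theorem Runs.mono {c : StkProg} {S S' m n} (h : Runs c S S' m) (hmn : m ≤ n) : Runs c S S' n :=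
  let ⟨t, ht, h⟩ := h
  ⟨t, ht.trans hmn, h⟩

theorem Runs.seq {c d : StkProg} {S S' S'' m n} (h : Runs c S S' m) (h' : Runs d S' S'' n) :
    Runs (.seq c d) S S'' (m + n) :=
  let ⟨_, ht, h⟩ := h
  let ⟨_, ht', h'⟩ := h'
  ⟨_, Nat.add_le_add ht ht', .seq h h'⟩

namespace StkProg

/-- Push a bit on a work stack. -/
def pushBit (k : Work) (b : Bool) : StkProg := .push (.work k) b

/-- Pop a bit from the main stack. -/
def caseMain (f : Option Bool → StkProg) : StkProg := .case (.work .main) f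

/-- Pop bits from a work stack until it is empty. -/
def loopBit (k : Work) (f : Bool → StkProg) : StkProg := .loop (.work k) f

section Runs

variable {i v : List Symbol} {o m x z c : List Bool} {S S' : ∀ k, List (StkSym k)} {t t' : ℕ}

/-! ### Timed runs of the stack routines -/

theorem runs_skip : Runs .skip S S 1 := ⟨_, le_rfl, .skip _⟩

theorem runs_push {k : Stk} (a : StkSym k) :
    Runs (.push k a) S (Function.update S k (a :: S k)) 1 := ⟨_, le_rfl, .push ..⟩

theorem runs_loop_nil {k : Stk} {f : StkSym k → StkProg} (h : S k = []) :
    Runs (.loop k f) S S 1 := ⟨_, le_rfl, .loop_nil h⟩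

theorem runs_loop_cons {k : Stk} {f : StkSym k → StkProg} {S₁ a l} (hS : S k = a :: l)
    (h : Runs (f a) (Function.update S k l) S₁ t) (h' : Runs (.loop k f) S₁ S' t') :
    Runs (.loop k f) S S' (t + t' + 1) :=
  let ⟨_, ht, h⟩ := h
  let ⟨_, ht', h'⟩ := h'
  ⟨_, by omega, .loop_cons hS h h'⟩

theorem runs_push_main (b : Bool) :
    Runs (pushBit .main b) (contents i v o m x z c) (contents i v o (b :: m) x z c) 1 := by
  have := runs_push (S := contents i v o m x z c) (k := .work .main) b
  rwa [update_contents_main] at this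

theorem runs_push_aux (b : Bool) :
    Runs (pushBit .aux b) (contents i v o m x z c) (contents i v o m (b :: x) z c) 1 := by
  have := runs_push (S := contents i v o m x z c) (k := .work .aux) b
  rwa [update_contents_aux] at this

theorem runs_push_tmp (b : Bool) :
    Runs (pushBit .tmp b) (contents i v o m x z c) (contents i v o m x (b :: z) c) 1 := by
  have := runs_push (S := contents i v o m x z c) (k := .work .tmp) b
  rwa [update_contents_tmp] at this

theorem runs_push_cnt (b : Bool) :
    Runs (pushBit .cnt b) (contents i v o m x z c) (contents i v o m x z (b :: c)) 1 := by
  have := runs_push (S := contents i v o m x z c) (k := .work .cnt) b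
  rwa [update_contents_cnt] at this

theorem runs_caseMain {b f} (h : Runs (f (some b)) (contents i v o m x z c) S t) :
    Runs (caseMain f) (contents i v o (b :: m) x z c) S (t + 1) := by
  obtain ⟨t', ht', h⟩ := h
  refine ⟨t' + 1, by omega, .case ?_⟩
  simpa using h

theorem runs_loop_aux_cons {b f S'} (h : Runs (f b) (contents i v o m x z c) S t)
    (h' : Runs (loopBit .aux f) S S' t') :
    Runs (loopBit .aux f) (contents i v o m (b :: x) z c) S' (t + t' + 1) :=
  runs_loop_cons (k := Stk.work .aux) (l := x) rfl (by simpa using h) h'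

theorem runs_loop_tmp_cons {b f S'} (h : Runs (f b) (contents i v o m x z c) S t)
    (h' : Runs (loopBit .tmp f) S S' t') :
    Runs (loopBit .tmp f) (contents i v o m x (b :: z) c) S' (t + t' + 1) :=
  runs_loop_cons (k := Stk.work .tmp) (l := z) rfl (by simpa using h) h'

theorem runs_loop_cnt_cons {b f S'} (h : Runs (f b) (contents i v o m x z c) S t)
    (h' : Runs (loopBit .cnt f) S S' t') :
    Runs (loopBit .cnt f) (contents i v o m x z (b :: c)) S' (t + t' + 1) :=
  runs_loop_cons (k := Stk.work .cnt) (l := c) rfl (by simpa using h) h'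

/-- Push a list of bits on the main stack so that its head is on top. -/
def pushAll : List Bool → StkProg
  | [] => .skip
  | b :: l => .seq (pushAll l) (pushBit .main b)

theorem runs_pushAll (l : List Bool) :
    Runs (pushAll l) (contents i v o m x z c) (contents i v o (l ++ m) x z c) (l.length + 1) := by
  induction l with
  | nil => exact runs_skip
  | cons b l ih =>
    refine (ih.seq (runs_push_main b)).mono ?_
    simp

/-- Popping from one stack onto another reverses the word. Each symbol costs a pop and a push, and
the last step finds the stack empty; the next four transfers are alike. -/
theorem runs_auxToMain :
    Runs (loopBit .aux (pushBit .main)) (contents i v o m x z c)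
      (contents i v o (x.reverse ++ m) [] z c) (2 * x.length + 1) := by
  induction x generalizing m with
  | nil => exact runs_loop_nil rfl
  | cons b x ih =>
    rw [List.reverse_cons, List.append_assoc]
    refine (runs_loop_aux_cons (runs_push_main b) ih).mono ?_
    simp only [List.length_cons]; omega

theorem runs_auxToTmp :
    Runs (loopBit .aux (pushBit .tmp)) (contents i v o m x z c)
      (contents i v o m [] (x.reverse ++ z) c) (2 * x.length + 1) := by
  induction x generalizing z with
  | nil => exact runs_loop_nil rfl
  | cons b x ih =>
    rw [List.reverse_cons, List.append_assoc]
    refine (runs_loop_aux_cons (runs_push_tmp b) ih).mono ?_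
    simp only [List.length_cons]; omega

theorem runs_tmpToAux :
    Runs (loopBit .tmp (pushBit .aux)) (contents i v o m x z c)
      (contents i v o m (z.reverse ++ x) [] c) (2 * z.length + 1) := by
  induction z generalizing x with
  | nil => exact runs_loop_nil rfl
  | cons b z ih =>
    rw [List.reverse_cons, List.append_assoc]
    refine (runs_loop_tmp_cons (runs_push_aux b) ih).mono ?_
    simp only [List.length_cons]; omega

theorem runs_tmpToCnt :
    Runs (loopBit .tmp (pushBit .cnt)) (contents i v o m x z c)
      (contents i v o m x [] (z.reverse ++ c)) (2 * z.length + 1) := by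
  induction z generalizing c with
  | nil => exact runs_loop_nil rfl
  | cons b z ih =>
    rw [List.reverse_cons, List.append_assoc]
    refine (runs_loop_tmp_cons (runs_push_cnt b) ih).mono ?_
    simp only [List.length_cons]; omega

theorem runs_cntToMain :
    Runs (loopBit .cnt (pushBit .main)) (contents i v o m x z c)
      (contents i v o (c.reverse ++ m) x z []) (2 * c.length + 1) := by
  induction c generalizing m with
  | nil => exact runs_loop_nil rfl
  | cons b c ih =>
    rw [List.reverse_cons, List.append_assoc]
    refine (runs_loop_cnt_cons (runs_push_main b) ih).mono ?_
    simp only [List.length_cons]; omega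

theorem runs_clearAux :
    Runs (loopBit .aux fun _ => .skip) (contents i v o m x z c) (contents i v o m [] z c)
      (2 * x.length + 1) := by
  induction x with
  | nil => exact runs_loop_nil rfl
  | cons b x ih =>
    refine (runs_loop_aux_cons runs_skip ih).mono ?_
    simp only [List.length_cons]; omega

theorem runs_auxToMainTmp :
    Runs (loopBit .aux fun b => .seq (pushBit .main b) (pushBit .tmp b)) (contents i v o m x z c)
      (contents i v o (x.reverse ++ m) [] (x.reverse ++ z) c) (3 * x.length + 1) := by
  induction x generalizing m z with
  | nil => exact runs_loop_nil rfl
  | cons b x ih =>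
    rw [List.reverse_cons, List.append_assoc, List.append_assoc]
    refine (runs_loop_aux_cons ((runs_push_main b).seq (runs_push_tmp b)) ih).mono ?_
    simp only [List.length_cons]; omega

/-- Move as many trees as the stack `cnt` has symbols from the main stack to the stack `aux`,
where their codes are reversed. -/
def moveLoop : StkProg :=
  loopBit .cnt fun _ => caseMain fun
    | some true => .seq (pushBit .aux true) (.seq (pushBit .cnt true) (pushBit .cnt true))
    | _ => pushBit .aux false

/-- A preorder code delimits itself: `cnt` counts the trees still to be moved, a leaf removes one,
and a node replaces one by two. Assuming the run that follows, instead of describing the state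
afterwards, lets the node case chain its two subtrees. A node symbol costs exactly five steps: two
pops and three pushes. -/
theorem runs_moveLoop {r : List Bool} (T : BTree)
    (h : Runs moveLoop (contents i v o r (T.code.reverse ++ x) z c) S t) :
    Runs moveLoop (contents i v o (T.code ++ r) x z (true :: c)) S (t + 5 * T.code.length) := by
  induction T generalizing r x c t with
  | leaf =>
    refine (runs_loop_cnt_cons (runs_caseMain (runs_push_aux false)) h).mono ?_
    simp only [BTree.code, List.length_singleton]; omega
  | node a b iha ihb =>
    simp only [BTree.code, List.reverse_cons, List.reverse_append, List.append_assoc,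
      List.cons_append, List.nil_append] at h ⊢
    refine (runs_loop_cnt_cons (runs_caseMain ((runs_push_aux true).seq
      ((runs_push_cnt true).seq (runs_push_cnt true)))) (iha (ihb h))).mono ?_
    simp only [List.length_cons, List.length_append]; omega

/-- Move a tree from the main stack to the stack `aux`, where its code is reversed. -/
def moveTree : StkProg := .seq (pushBit .cnt true) moveLoop

theorem runs_moveTree {r : List Bool} (T : BTree) :
    Runs moveTree (contents i v o (T.code ++ r) x z []) (contents i v o r (T.code.reverse ++ x) z [])
      (5 * T.code.length + 2) := by
  refine ((runs_push_cnt true).seq (runs_moveLoop T (runs_loop_nil rfl))).mono ?_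
  omega

/-- Remove the top tree of the main stack. -/
def dropTree : StkProg := .seq moveTree (loopBit .aux fun _ => .skip)

theorem runs_dropTree {r : List Bool} (T : BTree) :
    Runs dropTree (contents i v o (T.code ++ r) [] [] []) (contents i v o r [] [] [])
      (7 * T.code.length + 3) := by
  refine ((runs_moveTree T).seq runs_clearAux).mono ?_
  simp only [List.append_nil, List.length_reverse]; omega

/-- Duplicate the top tree of the main stack. -/
def dupTree : StkProg :=
  .seq moveTree (.seq (loopBit .aux fun b => .seq (pushBit .main b) (pushBit .tmp b))
    (.seq (loopBit .tmp (pushBit .aux)) (loopBit .aux (pushBit .main))))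

theorem runs_dupTree {r : List Bool} (T : BTree) :
    Runs dupTree (contents i v o (T.code ++ r) [] [] [])
      (contents i v o (T.code ++ (T.code ++ r)) [] [] []) (12 * T.code.length + 5) := by
  have := (runs_moveTree (i := i) (v := v) (o := o) (x := []) (z := []) (r := r) T).seq
    (runs_auxToMainTmp.seq (runs_tmpToAux.seq runs_auxToMain))
  simp only [List.append_nil, List.reverse_reverse, List.length_reverse] at this
  refine this.mono ?_
  omega

/-- Swap the two top trees of the main stack. -/
def swapTree : StkProg :=
  .seq moveTree (.seq (loopBit .aux (pushBit .tmp)) (.seq moveTree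
    (.seq (loopBit .tmp (pushBit .cnt)) (.seq (loopBit .cnt (pushBit .main))
      (loopBit .aux (pushBit .main))))))

/-- While `U` is moved, `aux` and `cnt` are in use, so `T` waits on `tmp`. It returns through `cnt`,
empty again by then, because a direct transfer to the main stack would reverse it. -/
theorem runs_swapTree {r : List Bool} (T U : BTree) :
    Runs swapTree (contents i v o (T.code ++ (U.code ++ r)) [] [] [])
      (contents i v o (U.code ++ (T.code ++ r)) [] [] [])
      (11 * T.code.length + 7 * U.code.length + 8) := by
  have := (runs_moveTree (i := i) (v := v) (o := o) (x := []) (z := []) (r := U.code ++ r) T).seq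
    (runs_auxToTmp.seq ((runs_moveTree (r := r) U).seq
      (runs_tmpToCnt.seq (runs_cntToMain.seq runs_auxToMain))))
  simp only [List.append_nil, List.reverse_reverse, List.length_reverse] at this
  refine this.mono ?_
  omega

end Runs

end StkProg

end KromImp

namespace KromImp

/-! ### Polynomial-time functions between types encoded by trees -/

/-- A type whose elements are represented by binary trees. -/
class TreeEnc (α : Type) where
  enc : α → BTree

open TreeEnc StkProg Polynomial

instance : TreeEnc Bool := ⟨fun b => if b then .node .leaf .leaf else .leaf⟩

instance {α β : Type} [TreeEnc α] [TreeEnc β] : TreeEnc (α × β) :=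
  ⟨fun p => .node (enc p.1) (enc p.2)⟩

/-- Lists are represented by right combs. -/
def encList {α : Type} [TreeEnc α] : List α → BTree
  | [] => .leaf
  | a :: l => .node (enc a) (encList l)

instance {α : Type} [TreeEnc α] : TreeEnc (List α) := ⟨encList⟩

instance {α : Type} [TreeEnc α] : TreeEnc (Option α) := ⟨fun o => enc o.toList⟩

instance : TreeEnc Literal := ⟨fun ℓ => enc (ℓ.var, ℓ.positive)⟩

variable {α β γ σ : Type} [TreeEnc α] [TreeEnc β] [TreeEnc γ] [TreeEnc σ]

/-- The bit string that represents `a`. -/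
def bits (a : α) : List Bool := (enc a).code

/-- The length of the bit string that represents `a`. -/
def size (a : α) : ℕ := (bits a).length

@[simp] theorem bits_pair (a : α) (b : β) : bits (a, b) = true :: (bits a ++ bits b) := rfl

@[simp] theorem bits_nil : bits ([] : List α) = [false] := rfl

@[simp] theorem bits_cons (a : α) (l : List α) : bits (a :: l) = true :: (bits a ++ bits l) := rfl

@[simp] theorem bits_true : bits true = [true, false, false] := rfl

@[simp] theorem bits_false : bits false = [false] := rfl

@[simp] theorem size_pair (a : α) (b : β) : size (a, b) = size a + size b + 1 := by
  simp [size]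

@[simp] theorem size_nil : size ([] : List α) = 1 := rfl

@[simp] theorem size_cons (a : α) (l : List α) : size (a :: l) = size a + size l + 1 := by
  simp [size]

theorem size_bool_le (b : Bool) : size b ≤ 3 := by
  cases b <;> decide

theorem size_pos (a : α) : 1 ≤ size a := BTree.length_code_pos _

theorem size_append (l m : List α) : size (l ++ m) + 1 = size l + size m := by
  induction l with
  | nil => simp [Nat.add_comm]
  | cons a l ih => simp only [List.cons_append, size_cons]; omega

theorem size_le_of_sublist {l m : List α} (h : l.Sublist m) : size l ≤ size m := by
  induction h with
  | slnil => rfl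
  | cons a _ ih => simp only [size_cons]; omega
  | cons_cons a _ ih => simp only [size_cons]; omega

theorem length_lt_size (l : List α) : l.length < size l := by
  induction l with
  | nil => simp
  | cons a l ih => simp only [List.length_cons, size_cons]; omega

/-- The coefficients are natural numbers, so no term decreases. This is what allows a bound on an
intermediate size to be substituted into the next time bound. -/
theorem monotone_eval (p : ℕ[X]) : Monotone fun n => p.eval n := by
  intro m n h
  simp only [eval_eq_sum_range]
  gcongr

/-- The configuration with the given main stack and with `v` still to be read. -/
abbrev conf (v : List Symbol) (m : List Bool) : ∀ k, List (StkSym k) := contents [] v [] m [] [] []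

/-- `f` is computed by a structured program in polynomial time, on the top of the main stack. -/
@[fun_prop]
def PolyTime (f : α → β) : Prop :=
  ∃ (c : StkProg) (p : ℕ[X]), ∀ a, size (f a) ≤ p.eval (size a) ∧
    ∀ v r, Runs c (conf v (bits a ++ r)) (conf v (bits (f a) ++ r)) (p.eval (size a))

namespace PolyTime

theorem of_enc_eq {f : α → β} (h : ∀ a, enc (f a) = enc a) : PolyTime f := by
  refine ⟨.skip, X, fun a => ?_⟩
  have h' : bits (f a) = bits a := congrArg BTree.code (h a)
  refine ⟨by simp [size, h'], fun v r => ?_⟩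
  rw [h']
  exact runs_skip.mono (by simpa using size_pos a)

@[fun_prop]
theorem id : PolyTime fun a : α => a := of_enc_eq fun _ => rfl

@[fun_prop]
theorem comp {g : β → γ} {f : α → β} (hg : PolyTime g) (hf : PolyTime f) :
    PolyTime fun a => g (f a) := by
  obtain ⟨c, p, hp⟩ := hf
  obtain ⟨d, q, hq⟩ := hg
  refine ⟨.seq c d, p + q.comp p, fun a => ⟨?_, fun v r => ?_⟩⟩
  · simp only [eval_add, eval_comp]
    exact (hq _).1.trans ((monotone_eval q (hp a).1).trans (Nat.le_add_left _ _))
  · simp only [eval_add, eval_comp]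
    exact (((hp a).2 v r).seq ((hq (f a)).2 v r)).mono
      (Nat.add_le_add_left (monotone_eval q (hp a).1) _)

@[fun_prop]
theorem const (b : β) : PolyTime fun _ : α => b := by
  refine ⟨.seq dropTree (pushAll (bits b)), 7 * X + C (size b + 4), fun a => ⟨?_, fun v r => ?_⟩⟩
  · simp; omega
  · refine ((runs_dropTree (enc a)).seq (runs_pushAll (bits b))).mono ?_
    simp [size, bits]; omega

-- The argument is duplicated, `f` consumes one copy and, after a swap, `g` the other. A second swap
-- restores the order, and the node mark makes the two trees a pair.
@[fun_prop]
theorem prodMk {f : α → β} {g : α → γ} (hf : PolyTime f) (hg : PolyTime g) :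
    PolyTime fun a => (f a, g a) := by
  obtain ⟨c, p, hp⟩ := hf
  obtain ⟨d, q, hq⟩ := hg
  refine ⟨.seq dupTree (.seq c (.seq swapTree (.seq d (.seq swapTree (pushBit .main true))))),
    30 * p + 30 * q + 40 * X + 30, fun a => ⟨?_, fun v r => ?_⟩⟩
  · have h1 := (hp a).1
    have h2 := (hq a).1
    simp; omega
  · have h1 := (hp a).1
    have h2 := (hq a).1
    rw [bits_pair, List.cons_append, List.append_assoc]
    refine ((runs_dupTree (enc a)).seq (((hp a).2 v _).seq ((runs_swapTree (enc (f a)) (enc a)).seq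
      (((hq a).2 v _).seq ((runs_swapTree (enc (g a)) (enc (f a))).seq
        (runs_push_main true)))))).mono ?_
    simp only [size, bits] at h1 h2 ⊢
    simp; omega

@[fun_prop]
theorem fst : PolyTime fun p : α × β => p.1 := by
  refine ⟨caseMain fun _ => .seq swapTree dropTree, 20 * X + 20, fun a => ⟨?_, fun v r => ?_⟩⟩
  · obtain ⟨a, b⟩ := a
    simp; omega
  · obtain ⟨a, b⟩ := a
    rw [bits_pair, List.cons_append, List.append_assoc]
    refine (runs_caseMain ((runs_swapTree (enc a) (enc b)).seq (runs_dropTree (enc b)))).mono ?_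
    rw [size_pair]
    simp [size, bits]; omega

@[fun_prop]
theorem snd : PolyTime fun p : α × β => p.2 := by
  refine ⟨caseMain fun _ => dropTree, 20 * X + 20, fun a => ⟨?_, fun v r => ?_⟩⟩
  · obtain ⟨a, b⟩ := a
    simp; omega
  · obtain ⟨a, b⟩ := a
    rw [bits_pair, List.cons_append, List.append_assoc]
    refine (runs_caseMain (runs_dropTree (enc a))).mono ?_
    rw [size_pair]
    simp [size, bits]; omega

/-- The test runs on a duplicate of the argument. As `true` is a node with two leaves, two more pops
clear its code. Stating `h` through equations covers functions defined by pattern matching. -/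
theorem bool_cases {g : α → Bool} {h f₀ f₁ : α → β} (hg : PolyTime g) (h₀ : PolyTime f₀)
    (h₁ : PolyTime f₁) (e₀ : ∀ a, g a = false → h a = f₀ a) (e₁ : ∀ a, g a = true → h a = f₁ a) :
    PolyTime h := by
  obtain ⟨c, p, hp⟩ := hg
  obtain ⟨c₀, p₀, hp₀⟩ := h₀
  obtain ⟨c₁, p₁, hp₁⟩ := h₁
  refine ⟨.seq dupTree (.seq c (caseMain fun
    | some true => caseMain fun _ => caseMain fun _ => c₁
    | _ => c₀)), p + p₀ + p₁ + 12 * X + 8, fun a => ?_⟩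
  cases hga : g a with
  | false =>
    rw [e₀ a hga]
    refine ⟨?_, fun v r => ?_⟩
    · have := (hp₀ a).1
      simp; omega
    · have := (hp a).2 v (bits a ++ r)
      rw [hga] at this
      refine ((runs_dupTree (enc a)).seq (this.seq (runs_caseMain ((hp₀ a).2 v r)))).mono ?_
      simp [size, bits]; omega
  | true =>
    rw [e₁ a hga]
    refine ⟨?_, fun v r => ?_⟩
    · have := (hp₁ a).1
      simp; omega
    · have := (hp a).2 v (bits a ++ r)
      rw [hga] at this
      refine ((runs_dupTree (enc a)).seq (this.seq (runs_caseMain (runs_caseMain (runs_caseMain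
        ((hp₁ a).2 v r)))))).mono ?_
      simp [size, bits]; omega

/-- The code of `b :: l` is also that of the pair `(b, l)`, so restoring the popped mark, swapping
and adding one more mark yields `(a, b, l)`. Its size exceeds that of `a` and `g a` by one, whence
the argument `X + p + 1`. -/
theorem list_cases {g : α → List β} {h f₀ : α → γ} {f₁ : α × β × List β → γ} (hg : PolyTime g)
    (h₀ : PolyTime f₀) (h₁ : PolyTime f₁) (e₀ : ∀ a, g a = [] → h a = f₀ a)
    (e₁ : ∀ a b l, g a = b :: l → h a = f₁ (a, b, l)) : PolyTime h := by
  obtain ⟨c, p, hp⟩ := hg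
  obtain ⟨c₀, p₀, hp₀⟩ := h₀
  obtain ⟨c₁, p₁, hp₁⟩ := h₁
  refine ⟨.seq dupTree (.seq c (caseMain fun
    | some true => .seq (pushBit .main true) (.seq swapTree (.seq (pushBit .main true) c₁))
    | _ => c₀)), 12 * p + p₀ + p₁.comp (X + p + 1) + 20 * X + 20, fun a => ?_⟩
  cases hga : g a with
  | nil =>
    rw [e₀ a hga]
    refine ⟨?_, fun v r => ?_⟩
    · have := (hp₀ a).1
      simp; omega
    · have := (hp a).2 v (bits a ++ r)
      rw [hga] at this
      refine ((runs_dupTree (enc a)).seq (this.seq (runs_caseMain ((hp₀ a).2 v r)))).mono ?_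
      simp [size, bits]; omega
  | cons b l =>
    rw [e₁ a b l hga]
    have hs : size (a, b, l) ≤ size a + p.eval (size a) + 1 := by
      have := (hp a).1
      rw [hga] at this
      simp at this ⊢; omega
    have hs' := monotone_eval p₁ hs
    refine ⟨?_, fun v r => ?_⟩
    · have := (hp₁ (a, b, l)).1
      simp at *; omega
    · have h1 := (hp a).2 v (bits a ++ r)
      have h2 := (hp a).1
      rw [hga] at h1 h2
      rw [bits_cons, List.cons_append, List.append_assoc] at h1
      have h3 := (hp₁ (a, b, l)).2 v r
      have h4 := runs_swapTree (i := []) (v := v) (o := []) (r := r) (enc (b, l)) (enc a)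
      have h5 := (runs_dupTree (enc a)).seq (h1.seq (runs_caseMain (f := fun
        | some true => .seq (pushBit .main true) (.seq swapTree (.seq (pushBit .main true) c₁))
        | _ => c₀) (b := true)
        ((runs_push_main true).seq (Runs.seq (by simpa [bits, enc, BTree.code] using h4)
          ((runs_push_main true).seq (by simpa [bits, enc, BTree.code] using h3))))))
      refine h5.mono ?_
      have e1 : (enc b).code.length = size b := rfl
      have e2 : (enc a).code.length = size a := rfl
      have e3 : (encList l).code.length = size l := rfl
      simp only [size_pair, size_cons] at *
      rw [e1, e2, e3]
      simp; omega

/-- Fold over the list in the top pair of the main stack; the stack `cnt` holds a flag for another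
round. -/
def foldLoop (c : StkProg) : StkProg :=
  loopBit .cnt fun _ => caseMain fun _ => caseMain fun
    | some true => .seq (pushBit .main true) (.seq (pushBit .main true)
        (.seq c (pushBit .cnt true)))
    | _ => .skip

/-- `N` bounds the remaining list and `B` every intermediate accumulator, so each round gets an
input of size at most `N + B + 1`. A bound on the final value alone would not control the rounds
before it. -/
theorem runs_foldLoop {f : σ → α → σ} {c : StkProg} {p : ℕ[X]}
    (hp : ∀ (a : α) (l : List α) (s : σ) v r, Runs c (conf v (bits (a :: l, s) ++ r))
      (conf v (bits (l, f s a) ++ r)) (p.eval (size (a :: l, s))))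
    {N B : ℕ} (l : List α) (s : σ) (hN : size l ≤ N)
    (hB : ∀ l', l' <+: l → size (l'.foldl f s) ≤ B) (v : List Symbol) (r : List Bool) :
    Runs (foldLoop c) (contents [] v [] (bits (l, s) ++ r) [] [] [true])
      (conf v (bits (l.foldl f s) ++ r)) ((l.length + 1) * (p.eval (N + B + 1) + 10)) := by
  induction l generalizing s with
  | nil =>
    refine (runs_loop_cnt_cons (b := true) (runs_caseMain (runs_caseMain (b := false) runs_skip))
      (runs_loop_nil rfl)).mono ?_
    simp
  | cons a l ih =>
    have h1 := ih (f s a) (by rw [size_cons] at hN; omega)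
      fun l' hl' => hB (a :: l') (List.cons_prefix_cons.2 ⟨rfl, hl'⟩)
    have h2 := (((hp a l s v r).seq (runs_push_cnt true)))
    refine (runs_loop_cnt_cons (b := true) (runs_caseMain (runs_caseMain (b := true)
      ((runs_push_main true).seq ((runs_push_main true).seq h2)))) h1).mono ?_
    have h3 : size (a :: l, s) ≤ N + B + 1 := by
      have := hB [] List.nil_prefix
      rw [size_pair, List.foldl_nil] at *
      omega
    have := monotone_eval p h3
    simp only [List.length_cons, add_mul] at *
    omega

theorem foldl_pair {f : σ → α → σ} (hf : PolyTime fun p : σ × α => f p.1 p.2) (q : ℕ[X])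
    (hq : ∀ (l : List α) s, size (l.foldl f s) ≤ q.eval (size l + size s)) :
    PolyTime fun p : List α × σ => p.1.foldl f p.2 := by
  have hg : PolyTime fun p : (α × List α) × σ => (p.1.2, f p.2 p.1.1) :=
    prodMk (comp snd fst) (hf.comp (prodMk snd (comp fst fst)))
  obtain ⟨c, p, hp⟩ := hg
  refine ⟨.seq (pushBit .cnt true) (foldLoop c), (X + 1) * (p.comp (X + q + 1) + 10) + 1 + q,
    fun ⟨l, s⟩ => ?_⟩
  have hs : size l + size s ≤ size (l, s) := by rw [size_pair]; omega
  have hB : ∀ l', l' <+: l → size (l'.foldl f s) ≤ q.eval (size (l, s)) := fun l' hl' =>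
    (hq l' s).trans (monotone_eval q
      ((Nat.add_le_add_right (size_le_of_sublist hl'.sublist) _).trans hs))
  refine ⟨(hB l (List.prefix_refl l)).trans (by simp), fun v r => ?_⟩
  -- `((a, l), s)` and `(a :: l, s)` have the same code, so the program for the step applies
  -- unchanged.
  have := runs_foldLoop (fun a l s v r => (hp ((a, l), s)).2 v r) l s
    (show size l ≤ size (l, s) by omega) hB v r
  refine ((runs_push_cnt true).seq this).mono ?_
  have h1 : l.length + 1 ≤ size (l, s) + 1 := by have := length_lt_size l; omega
  have h2 := Nat.mul_le_mul_right
    (p.eval (size (l, s) + q.eval (size (l, s)) + 1) + 10) h1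
  simp only [eval_add, eval_mul, eval_comp, eval_X, eval_one, eval_ofNat]
  omega

/-- The increment `q` does not depend on the accumulator `b`, so after all rounds the growth is at
most the length times a polynomial; repeated doubling is excluded. The parameter `c` travels along
unchanged inside the accumulator of `F`. -/
theorem foldl {l : γ → List α} {b : γ → β} {f : γ → β → α → β} (hl : PolyTime l)
    (hb : PolyTime b) (hf : PolyTime fun p : γ × β × α => f p.1 p.2.1 p.2.2) (q : ℕ[X])
    (hq : ∀ c b a, size (f c b a) ≤ size b + q.eval (size c + size a)) :
    PolyTime fun c => (l c).foldl (f c) (b c) := by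
  let F : γ × β → α → γ × β := fun s a => (s.1, f s.1 s.2 a)
  have hF : ∀ l c b, List.foldl F (c, b) l = (c, List.foldl (f c) b l) := by
    intro l
    induction l with
    | nil => intros; rfl
    | cons a l ih => intro c b; exact ih c (f c b a)
  have hsize : ∀ l c b, size (List.foldl (f c) b l) ≤
      size b + l.length * q.eval (size c + size l) := by
    intro l
    induction l with
    | nil => intros; simp
    | cons a l ih =>
      intro c b
      have h1 := ih c (f c b a)
      have h2 := hq c b a
      have h3 : q.eval (size c + size a) ≤ q.eval (size c + size (a :: l)) :=
        monotone_eval q (by rw [size_cons]; omega)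
      have h4 : q.eval (size c + size l) ≤ q.eval (size c + size (a :: l)) :=
        monotone_eval q (by rw [size_cons]; omega)
      have h5 := Nat.mul_le_mul_left l.length h4
      simp only [List.foldl_cons, List.length_cons, add_mul, one_mul]
      omega
  have hstep : PolyTime fun p : (γ × β) × α => F p.1 p.2 :=
    prodMk (comp fst fst) (hf.comp
      (prodMk (comp fst fst) (prodMk (comp snd fst) snd)))
  have := foldl_pair hstep (X + X * q) (by
    rintro l ⟨c, b⟩
    rw [hF]
    have h1 := hsize l c b
    have h2 : q.eval (size c + size l) ≤ q.eval (size l + size (c, b)) :=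
      monotone_eval q (by simp; omega)
    have h3 : l.length ≤ size l + size (c, b) := by have := length_lt_size l; omega
    have h4 := Nat.mul_le_mul h3 h2
    simp only [eval_add, eval_mul, eval_X]
    simp only [size_pair] at *
    omega)
  have h := comp snd (this.comp (prodMk hl (prodMk id hb)))
  simpa only [hF] using h

end PolyTime

end KromImp

namespace KromImp

open TreeEnc StkProg Polynomial

variable {α β γ : Type} [TreeEnc α] [TreeEnc β] [TreeEnc γ]

namespace PolyTime

/-! ### Boolean and list operations -/

@[fun_prop]
theorem and {f g : α → Bool} (hf : PolyTime f) (hg : PolyTime g) : PolyTime fun a => f a && g a :=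
  bool_cases hf (const false) hg (fun a h => by simp [h]) (fun a h => by simp [h])

@[fun_prop]
theorem or {f g : α → Bool} (hf : PolyTime f) (hg : PolyTime g) : PolyTime fun a => f a || g a :=
  bool_cases hf hg (const true) (fun a h => by simp [h]) (fun a h => by simp [h])

@[fun_prop]
theorem not {f : α → Bool} (hf : PolyTime f) : PolyTime fun a => !f a :=
  bool_cases hf (const true) (const false) (fun a h => by simp [h]) (fun a h => by simp [h])

theorem ite {g : α → Bool} {f₁ f₀ : α → β} (hg : PolyTime g) (h₁ : PolyTime f₁)
    (h₀ : PolyTime f₀) : PolyTime fun a => if g a then f₁ a else f₀ a :=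
  bool_cases hg h₀ h₁ (fun a h => by simp [h]) (fun a h => by simp [h])

@[fun_prop]
theorem cons {f : α → β} {g : α → List β} (hf : PolyTime f) (hg : PolyTime g) :
    PolyTime fun a => f a :: g a :=
  comp (g := fun p : β × List β => p.1 :: p.2) (of_enc_eq fun _ => rfl) (prodMk hf hg)

@[fun_prop]
theorem isEmpty {g : α → List β} (hg : PolyTime g) : PolyTime fun a => (g a).isEmpty :=
  list_cases hg (const true) (const false) (fun a h => by simp [h]) (fun a b l h => by simp [h])

theorem any {l : γ → List α} {P : γ → α → Bool} (hl : PolyTime l)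
    (hP : PolyTime fun p : γ × α => P p.1 p.2) : PolyTime fun c => (l c).any (P c) := by
  have h : ∀ (P : α → Bool) (l : List α) b, l.foldl (fun b a => b || P a) b = (b || l.any P) := by
    intro P l
    induction l with
    | nil => simp
    | cons a l ih => simp [ih, Bool.or_assoc]
  have := foldl (f := fun c b a => b || P c a) hl (const false) (by fun_prop) 3
    (fun c b a => (size_bool_le _).trans (by simp))
  simpa [h] using this

theorem all {l : γ → List α} {P : γ → α → Bool} (hl : PolyTime l)
    (hP : PolyTime fun p : γ × α => P p.1 p.2) : PolyTime fun c => (l c).all (P c) := by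
  simp only [List.all_eq_not_any_not]
  exact not (any (P := fun c a => !P c a) hl (not hP))

@[fun_prop]
theorem reverse {l : γ → List α} (hl : PolyTime l) : PolyTime fun c => (l c).reverse := by
  have := foldl (f := fun _ (b : List α) a => a :: b) hl (const []) (by fun_prop) (X + 1)
    (fun c b a => by simp; omega)
  simpa using this

@[fun_prop]
theorem append {l m : γ → List α} (hl : PolyTime l) (hm : PolyTime m) :
    PolyTime fun c => l c ++ m c := by
  have := foldl (f := fun _ (b : List α) a => a :: b) hl.reverse hm (by fun_prop) (X + 1)
    (fun c b a => by simp; omega)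
  simpa using this

theorem map {l : γ → List α} {f : γ → α → β} (hl : PolyTime l)
    (hf : PolyTime fun p : γ × α => f p.1 p.2) : PolyTime fun c => (l c).map (f c) := by
  obtain ⟨_, p, hp⟩ := _root_.id hf
  have := foldl (f := fun c (b : List β) a => f c a :: b) hl.reverse (const []) (by fun_prop)
    (p.comp (X + 1) + 1) (fun c b a => by
      have := (hp (c, a)).1
      simp only [size_pair, size_cons, eval_add, eval_comp, eval_X, eval_one] at *
      omega)
  simpa using this

/-- A left fold over the reversed list is a right fold, which keeps the order of the elements; `map`
and `flatten` use the same device. -/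
theorem filter {l : γ → List α} {P : γ → α → Bool} (hl : PolyTime l)
    (hP : PolyTime fun p : γ × α => P p.1 p.2) : PolyTime fun c => (l c).filter (P c) := by
  have := foldl (f := fun c (b : List α) a => if P c a then a :: b else b) hl.reverse (const [])
    (ite (by fun_prop) (by fun_prop) (by fun_prop))
    (X + 1) (fun c b a => by split_ifs <;> simp; omega)
  have h : ∀ c (l : List α),
      l.foldr (fun a b => if P c a then a :: b else b) [] = l.filter (P c) := by
    intro c l
    induction l with
    | nil => rfl
    | cons a l ih => simp [ih, List.filter_cons]
  simpa [h] using this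

@[fun_prop]
theorem flatten {l : γ → List (List α)} (hl : PolyTime l) : PolyTime fun c => (l c).flatten := by
  have := foldl (f := fun _ (b a : List α) => a ++ b) hl.reverse (const []) (by fun_prop) X
    (fun c b a => by have := size_append a b; simp; omega)
  have h : ∀ l : List (List α), l.foldr (fun a b => a ++ b) [] = l.flatten := by
    intro l
    induction l with
    | nil => rfl
    | cons a l ih => simp [ih]
  simpa [h] using this

theorem flatMap {l : γ → List α} {f : γ → α → List β} (hl : PolyTime l)
    (hf : PolyTime fun p : γ × α => f p.1 p.2) : PolyTime fun c => (l c).flatMap (f c) := by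
  simp only [List.flatMap_def]
  exact flatten (map hl hf)

end PolyTime

/-! ### Literals and polynomial-time equality tests -/

@[fun_prop]
theorem PolyTime.literal_var {f : α → Literal} (hf : PolyTime f) : PolyTime fun a => (f a).var :=
  (PolyTime.fst.comp (PolyTime.of_enc_eq (f := fun ℓ : Literal => (ℓ.var, ℓ.positive))
    fun _ => rfl)).comp hf

@[fun_prop]
theorem PolyTime.literal_positive {f : α → Literal} (hf : PolyTime f) :
    PolyTime fun a => (f a).positive :=
  (PolyTime.snd.comp (PolyTime.of_enc_eq (f := fun ℓ : Literal => (ℓ.var, ℓ.positive))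
    fun _ => rfl)).comp hf

@[fun_prop]
theorem PolyTime.literal_mk {f : α → List Bool} {g : α → Bool} (hf : PolyTime f)
    (hg : PolyTime g) : PolyTime fun a => Literal.mk (f a) (g a) :=
  (PolyTime.of_enc_eq (f := fun p : List Bool × Bool => Literal.mk p.1 p.2)
    fun _ => rfl).comp (hf.prodMk hg)

/-- Types with a polynomial-time equality test. -/
class PolyEq (α : Type) [TreeEnc α] [DecidableEq α] : Prop where
  polyTime_eq : PolyTime fun p : α × α => decide (p.1 = p.2)

section PolyEq

variable [DecidableEq α] [DecidableEq β] [PolyEq α] [PolyEq β]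

@[fun_prop]
theorem PolyTime.decide_eq {f g : γ → α} (hf : PolyTime f) (hg : PolyTime g) :
    PolyTime fun c => decide (f c = g c) :=
  PolyEq.polyTime_eq.comp (hf.prodMk hg)

@[fun_prop]
theorem PolyTime.decide_mem {f : γ → α} {l : γ → List α} [∀ c, Decidable (f c ∈ l c)]
    (hf : PolyTime f) (hl : PolyTime l) : PolyTime fun c => decide (f c ∈ l c) := by
  have := PolyTime.any (P := fun c a => decide (f c = a)) hl (by fun_prop)
  convert this using 2 with c
  rw [Bool.eq_iff_iff]
  simp

instance : PolyEq Bool where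
  polyTime_eq := PolyTime.bool_cases (f₀ := fun p => !p.2) (f₁ := fun p => p.2) PolyTime.fst
    (by fun_prop) (by fun_prop) (fun p h => by simp [h])
    (fun p h => by simp [h])

instance : PolyEq (α × β) where
  polyTime_eq := by
    simp only [Prod.ext_iff, Bool.decide_and]
    fun_prop

instance : PolyEq (List α) where
  polyTime_eq := by
    -- The accumulator holds a flag and the unmatched rest of the second list. The lists agree iff
    -- the flag survives and nothing is left over; a second list that is too short clears the flag.
    let F : Bool × List α → α → Bool × List α := fun s a => match s.2 with
      | [] => (false, [])
      | b :: l => (s.1 && decide (a = b), l)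
    have hF : PolyTime fun p : (List α × List α) × (Bool × List α) × α => F p.2.1 p.2.2 :=
      PolyTime.list_cases (g := fun p => p.2.1.2) (f₀ := fun _ => (false, []))
        (f₁ := fun p => (p.1.2.1.1 && decide (p.1.2.2 = p.2.1), p.2.2))
        (by fun_prop) (by fun_prop) (by fun_prop)
        (fun p h => by simp only [F, h]) (fun p b l h => by simp only [F, h])
    have key : ∀ (l m : List α) b, ((l.foldl F (b, m)).1 && (l.foldl F (b, m)).2.isEmpty) =
        (b && decide (l = m)) := by
      intro l
      induction l with
      | nil => intro m b; cases m <;> simp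
      | cons a l ih =>
        intro m b
        cases m with
        | nil => simp [F, ih]
        | cons a' m => simp [F, ih, Bool.and_assoc]
    have := PolyTime.foldl (l := fun p : List α × List α => p.1) (b := fun p => (true, p.2))
      (f := fun _ => F) (by fun_prop) (by fun_prop) hF 4 (by
        rintro - ⟨b, _ | ⟨a', m⟩⟩ a
        · have := size_bool_le false
          simp [F]; omega
        · have := size_bool_le (b && decide (a = a'))
          simp [F]; omega)
    simpa [key] using (PolyTime.fst.comp this).and (PolyTime.snd.comp this).isEmpty

instance : PolyEq Literal where
  polyTime_eq := by
    have : ∀ a b : Literal, a = b ↔ a.var = b.var ∧ a.positive = b.positive := by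
      rintro ⟨v, p⟩ ⟨w, q⟩
      simp
    simp only [this, Bool.decide_and]
    fun_prop

end PolyEq

end KromImp

namespace KromImp

open Relation

/-! ### Satisfiability of Krom formulas by transitive closure of the implication graph -/

/-- The complementary literal. -/
def Literal.neg (ℓ : Literal) : Literal := ⟨ℓ.var, !ℓ.positive⟩

@[simp] theorem Literal.neg_neg (ℓ : Literal) : ℓ.neg.neg = ℓ := by
  simp [Literal.neg]

theorem Literal.ne_neg (ℓ : Literal) : ℓ ≠ ℓ.neg := by
  intro h
  have := congrArg Literal.positive h
  simp [Literal.neg] at this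

@[simp] theorem Literal.eval_neg (θ : Assignment) (ℓ : Literal) : ℓ.neg.eval θ = !ℓ.eval θ := by
  rcases ℓ with ⟨v, _ | _⟩ <;> simp [Literal.neg, Literal.eval]

/-- An implication relation on literals that is closed under contraposition, and has no cycle
through complementary literals, is respected by some assignment. -/
theorem exists_assignment {r : Literal → Literal → Prop} (hr : ∀ x y, r x y → r y.neg x.neg)
    (hc : ∀ x, ¬(TransGen r x x.neg ∧ TransGen r x.neg x)) :
    ∃ θ : Assignment, ∀ x y, r x y → x.eval θ = true → y.eval θ = true := by
  have hcontra : ∀ x y, ReflTransGen r x y → ReflTransGen r y.neg x.neg := by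
    intro x y h
    induction h with
    | refl => exact .refl
    | tail _ h ih => exact .head (hr _ _ h) ih
  have hc' : ∀ x, ReflTransGen r x x.neg → ¬ ReflTransGen r x.neg x := by
    intro x h h'
    rw [reflTransGen_iff_eq_or_transGen] at h h'
    exact hc x ⟨h.resolve_left fun e => x.ne_neg e.symm, h'.resolve_left x.ne_neg⟩
  -- `T` is a maximal consistent set of literals closed under reachability; it becomes the set of
  -- true literals.
  obtain ⟨T, ⟨hT, hT'⟩, hmax⟩ := zorn_subset
    {T : Set Literal | (∀ x y, x ∈ T → ReflTransGen r x y → y ∈ T) ∧ ∀ x ∈ T, x.neg ∉ T} (by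
      intro C hC hchain
      refine ⟨⋃₀ C, ⟨?_, ?_⟩, fun _ => Set.subset_sUnion_of_mem⟩
      · rintro x y ⟨A, hA, hx⟩ hxy
        exact ⟨A, hA, (hC hA).1 x y hx hxy⟩
      · rintro x ⟨A, hA, hx⟩ ⟨B, hB, hx'⟩
        rcases hchain.total hA hB with h | h
        · exact (hC hB).2 x (h hx) hx'
        · exact (hC hA).2 x hx (h hx'))
  -- Adding everything reachable from `x` preserves closure. By contraposition, a clash with `T`
  -- would put `x.neg` in `T`, and a clash among the new literals would give a path from `x` to
  -- `x.neg`. Maximality then puts `x` in `T`.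
  have extend : ∀ x, ¬ ReflTransGen r x x.neg → x.neg ∉ T → x ∈ T := by
    intro x hx hxT
    refine hmax (y := T ∪ {y | ReflTransGen r x y}) ⟨?_, ?_⟩ Set.subset_union_left
      (Or.inr ReflTransGen.refl)
    · rintro y z (hy | hy) hyz
      · exact Or.inl (hT y z hy hyz)
      · exact Or.inr (ReflTransGen.trans hy hyz)
    · rintro y (hy | hy) (hy' | hy')
      · exact hT' y hy hy'
      · exact hxT (hT y _ hy (by simpa using hcontra _ _ hy'))
      · exact hxT (hT _ _ hy' (hcontra _ _ hy))
      · exact hx (ReflTransGen.trans hy (by simpa using hcontra _ _ hy'))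
  -- At least one of `x` and `x.neg` fails to reach its complement, so `extend` applies to that one.
  have htotal : ∀ x, x ∈ T ∨ x.neg ∈ T := by
    intro x
    by_contra! h
    by_cases hx : ReflTransGen r x x.neg
    · exact h.2 (extend x.neg (by simpa using hc' x hx) (by simpa using h.1))
    · exact h.1 (extend x hx h.2)
  classical
  have heval : ∀ x : Literal, x.eval (fun v => decide (⟨v, true⟩ ∈ T)) = true ↔ x ∈ T := by
    rintro ⟨v, _ | _⟩
    · have h1 := htotal ⟨v, true⟩
      have h2 := hT' ⟨v, true⟩
      simp only [Literal.eval, Literal.neg] at *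
      simp only [Bool.not_true] at *
      simp
      tauto
    · simp [Literal.eval]
  refine ⟨fun v => decide (⟨v, true⟩ ∈ T), fun x y hxy hx => ?_⟩
  rw [heval] at hx ⊢
  exact hT x y hx (.single hxy)

/-- Whether a clause, written as a list, contains the implication from `x` to `y`. -/
def implies (S : List (List Literal)) (x y : Literal) : Bool :=
  S.any fun c => decide (x.neg ∈ c) && decide (y ∈ c) &&
    c.all fun ℓ => decide (ℓ = x.neg) || decide (ℓ = y)

/-- The literals of the clauses and their complements. -/
def literals (S : List (List Literal)) : List Literal :=
  S.flatten ++ S.flatten.map Literal.neg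

/-- All pairs of elements of a list. -/
def pairs (U : List Literal) : List (Literal × Literal) :=
  U.flatMap fun x => U.map fun y => (x, y)

/-- Add to `E` the pairs that are connected through `k`. -/
def connect (U : List Literal) (E : List (Literal × Literal)) (k : Literal) :
    List (Literal × Literal) :=
  (pairs U).filter fun p => decide (p ∈ E) || decide ((p.1, k) ∈ E) && decide ((k, p.2) ∈ E)

/-- The transitive closure of the implication relation. -/
def implications (S : List (List Literal)) : List (Literal × Literal) :=
  (literals S).foldl (connect (literals S))
    ((pairs (literals S)).filter fun p => implies S p.1 p.2)

/-- The unsatisfiability test. -/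
def unsat (S : List (List Literal)) : Bool :=
  S.any List.isEmpty || (literals S).any fun x =>
    decide ((x, x.neg) ∈ implications S) && decide ((x.neg, x) ∈ implications S)

/-- Whether a list of literals has at most two different members. -/
def isKrom (c : List Literal) : Bool :=
  c.isEmpty || c.any fun a => c.any fun b => c.all fun ℓ => decide (ℓ = a) || decide (ℓ = b)

/-- The decision procedure on parsed instances. -/
def decideInstance (p : List (List (List Literal))) (f : List (List Literal)) : Bool :=
  (p.all fun φ => φ.all isKrom) && f.all isKrom &&
    f.all fun c => unsat (p.flatten ++ c.map fun ℓ => [ℓ.neg])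

/-! Correctness -/

theorem mem_pairs {U : List Literal} {x y : Literal} : (x, y) ∈ pairs U ↔ x ∈ U ∧ y ∈ U := by
  simp [pairs]

theorem mem_connect {U : List Literal} {E : List (Literal × Literal)} {k x y : Literal}
    (hE : E ⊆ pairs U) :
    (x, y) ∈ connect U E k ↔ (x, y) ∈ E ∨ (x, k) ∈ E ∧ (k, y) ∈ E := by
  simp only [connect, List.mem_filter, Bool.or_eq_true, Bool.and_eq_true, decide_eq_true_eq]
  refine ⟨fun h => h.2, fun h => ⟨?_, h⟩⟩
  rcases h with h | ⟨h, h'⟩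
  · exact hE h
  · exact mem_pairs.2 ⟨(mem_pairs.1 (hE h)).1, (mem_pairs.1 (hE h')).2⟩

/-- Warshall's invariant: `P` collects the literals already admitted as intermediate points, and
paths of two edges through them are already shortcut. The transitive relation `R` bounds the result
from above. -/
theorem mem_foldl_connect {U : List Literal} {R : Literal → Literal → Prop}
    (hR : ∀ x y z, R x y → R y z → R x z) (ks : List Literal) :
    ∀ (E : List (Literal × Literal)) (P : Literal → Prop), E ⊆ pairs U →
      (∀ m, P m → ∀ x y, (x, m) ∈ E → (m, y) ∈ E → (x, y) ∈ E) →
      (∀ x y, (x, y) ∈ E → R x y) →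
      E ⊆ ks.foldl (connect U) E ∧ ks.foldl (connect U) E ⊆ pairs U ∧
      (∀ m, P m ∨ m ∈ ks → ∀ x y, (x, m) ∈ ks.foldl (connect U) E →
        (m, y) ∈ ks.foldl (connect U) E → (x, y) ∈ ks.foldl (connect U) E) ∧
      ∀ x y, (x, y) ∈ ks.foldl (connect U) E → R x y := by
  induction ks with
  | nil =>
    intro E P hE hP hER
    exact ⟨List.Subset.refl _, hE, by simpa using hP, hER⟩
  | cons k ks ih =>
    intro E P hE hP hER
    obtain ⟨h1, h2, h3, h4⟩ := ih (connect U E k) (fun m => P m ∨ m = k)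
      List.filter_sublist.subset (by
        rintro m (hm | rfl) x y hx hy
        · have := hP m hm
          rw [mem_connect hE] at hx hy ⊢
          -- Each of the two edges at `m` is old or was made through `k`. If both are new, their
          -- outer halves already lead from `x` to `k` and from `k` to `y`.
          rcases hx with hx | ⟨hx, hx'⟩ <;> rcases hy with hy | ⟨hy, hy'⟩
          · exact .inl (this _ _ hx hy)
          · exact .inr ⟨this _ _ hx hy, hy'⟩
          · exact .inr ⟨hx, this _ _ hx' hy⟩
          · exact .inr ⟨hx, hy'⟩
        · rw [mem_connect hE] at hx hy ⊢
          exact .inr ⟨by tauto, by tauto⟩) (by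
        intro x y h
        rcases (mem_connect hE).1 h with h | ⟨h, h'⟩
        · exact hER _ _ h
        · exact hR _ _ _ (hER _ _ h) (hER _ _ h'))
    refine ⟨fun p hp => h1 ?_, h2, fun m hm => h3 m ?_, h4⟩
    · obtain ⟨x, y⟩ := p
      exact (mem_connect hE).2 (.inl hp)
    · simp only [List.mem_cons] at hm
      tauto

/-- The last condition makes the clause exactly `¬x ∨ y`. The case `x.neg = y` is included, so a
unit clause gives an edge from the complement of its literal to the literal. -/
theorem implies_iff {S : List (List Literal)} {x y : Literal} : implies S x y = true ↔
    ∃ c ∈ S, x.neg ∈ c ∧ y ∈ c ∧ ∀ ℓ ∈ c, ℓ = x.neg ∨ ℓ = y := by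
  simp [implies, and_assoc]

theorem implies_mem {S : List (List Literal)} {x y : Literal} (h : implies S x y = true) :
    x ∈ literals S ∧ y ∈ literals S := by
  obtain ⟨c, hc, hx, hy, -⟩ := implies_iff.1 h
  simp only [literals, List.mem_append, List.mem_flatten, List.mem_map]
  exact ⟨.inr ⟨x.neg, ⟨c, hc, hx⟩, x.neg_neg⟩, .inl ⟨c, hc, hy⟩⟩

/-- One pass suffices: every intermediate point of a path is an endpoint of an edge, hence occurs in
`literals S` and has been admitted. -/
theorem mem_implications {S : List (List Literal)} {x y : Literal} :
    (x, y) ∈ implications S ↔ TransGen (fun x y => implies S x y = true) x y := by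
  obtain ⟨h1, h2, h3, h4⟩ := mem_foldl_connect (U := literals S)
    (R := TransGen fun x y => implies S x y = true) (fun x y z => TransGen.trans) (literals S)
    ((pairs (literals S)).filter fun p => implies S p.1 p.2) (fun _ => False)
    List.filter_sublist.subset (by simp)
    (fun x y h => .single (List.mem_filter.1 h).2)
  have hbase : ∀ x y, implies S x y = true → (x, y) ∈ implications S := fun x y h =>
    h1 (List.mem_filter.2 ⟨mem_pairs.2 (implies_mem h), h⟩)
  refine ⟨h4 x y, fun h => ?_⟩
  induction h with
  | single h => exact hbase _ _ h
  | tail _ h ih => exact h3 _ (.inr (implies_mem h).1) _ _ ih (hbase _ _ h)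

theorem isKrom_iff {c : List Literal} : isKrom c = true ↔ c.toFinset.card ≤ 2 := by
  simp only [isKrom, Bool.or_eq_true, List.isEmpty_iff, List.any_eq_true, List.all_eq_true,
    decide_eq_true_eq]
  constructor
  · rintro (rfl | ⟨a, -, b, -, h⟩)
    · simp
    · refine (Finset.card_le_card (t := {a, b}) fun ℓ hℓ => ?_).trans Finset.card_le_two
      simpa using h ℓ (by simpa using hℓ)
  · intro h
    rcases c with _ | ⟨a, c⟩
    · exact .inl rfl
    right
    refine ⟨a, List.mem_cons_self, ?_⟩
    by_cases hc : ∃ b ∈ c, b ≠ a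
    · obtain ⟨b, hb, hba⟩ := hc
      refine ⟨b, List.mem_cons_of_mem _ hb, fun ℓ hℓ => ?_⟩
      by_contra! hne
      have : ({a, b, ℓ} : Finset Literal) ⊆ (a :: c).toFinset := by
        intro z hz
        simp only [Finset.mem_insert, Finset.mem_singleton] at hz
        rw [List.mem_toFinset]
        rcases hz with rfl | rfl | rfl
        · exact List.mem_cons_self
        · exact List.mem_cons_of_mem _ hb
        · exact hℓ
      have h3 := Finset.card_le_card this
      rw [Finset.card_eq_three.2 ⟨a, b, ℓ, hba.symm, hne.1.symm, hne.2.symm, rfl⟩] at h3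
      omega
    · push Not at hc
      refine ⟨a, List.mem_cons_self, fun ℓ hℓ => ?_⟩
      rcases List.mem_cons.1 hℓ with h | h
      · exact .inl h
      · exact .inl (hc ℓ h)

/-- Truth propagates along edges, so a cycle through `x` and `x.neg` would give both the same value.
Without such a cycle, `exists_assignment` respects all edges, and in a clause `{a, b}` with `a`
false the edge from `a.neg` makes `b` true. Empty clauses produce no edge and are tested separately.
-/
theorem unsat_iff {S : List (List Literal)} (hS : ∀ c ∈ S, isKrom c = true) :
    unsat S = true ↔ ∀ θ : Assignment, ¬ ∀ c ∈ S, ∃ ℓ ∈ c, ℓ.eval θ = true := by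
  simp only [unsat, Bool.or_eq_true, List.any_eq_true, List.isEmpty_iff, Bool.and_eq_true,
    decide_eq_true_eq, mem_implications]
  constructor
  · rintro (⟨c, hc, rfl⟩ | ⟨x, -, h, h'⟩) θ hθ
    · simpa using hθ _ hc
    · have key : ∀ x y, TransGen (fun x y => implies S x y = true) x y →
          x.eval θ = true → y.eval θ = true := by
        intro x y h
        induction h with
        | single h =>
          intro hx
          obtain ⟨c, hc, -, -, hall⟩ := implies_iff.1 h
          obtain ⟨ℓ, hℓ, hℓ'⟩ := hθ c hc
          rcases hall ℓ hℓ with rfl | rfl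
          · simp [hx] at hℓ'
          · exact hℓ'
        | tail _ h ih =>
          intro hx
          obtain ⟨c, hc, -, -, hall⟩ := implies_iff.1 h
          obtain ⟨ℓ, hℓ, hℓ'⟩ := hθ c hc
          rcases hall ℓ hℓ with rfl | rfl
          · simp [ih hx] at hℓ'
          · exact hℓ'
      have h1 := key _ _ h
      have h2 := key _ _ h'
      rw [Literal.eval_neg] at h1 h2
      cases hx : x.eval θ <;> simp [hx] at h1 h2
  · intro h
    by_contra! hcon
    obtain ⟨hne, hcyc⟩ := hcon
    obtain ⟨θ, hθ⟩ := exists_assignment (r := fun x y => implies S x y = true) (by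
      intro x y hxy
      obtain ⟨c, hc, hx, hy, hall⟩ := implies_iff.1 hxy
      exact implies_iff.2 ⟨c, hc, by simpa using hy, hx, fun ℓ hℓ => by
        simpa using (hall ℓ hℓ).symm⟩) (by
      rintro x ⟨hx, hx'⟩
      -- The test only searches `literals S`, but a literal on a cycle has an outgoing edge and
      -- therefore lies there.
      refine hcyc x ?_ hx hx'
      obtain ⟨y, hxy, -⟩ := TransGen.head'_iff.1 hx
      exact (implies_mem hxy).1)
    refine h θ fun c hc => ?_
    have hk := hS c hc
    simp only [isKrom, Bool.or_eq_true, List.isEmpty_iff, List.any_eq_true, List.all_eq_true,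
      decide_eq_true_eq] at hk
    rcases hk with rfl | ⟨a, ha, b, hb, hall⟩
    · exact absurd rfl (hne _ hc)
    · by_cases hav : a.eval θ = true
      · exact ⟨a, ha, hav⟩
      · refine ⟨b, hb, hθ a.neg b (implies_iff.2 ⟨c, hc, by simpa using ha, hb, ?_⟩) ?_⟩
        · simpa using hall
        · simpa using hav

theorem toCNF_satisfiedBy {f : List (List Literal)} {θ : Assignment} :
    CNF.SatisfiedBy (toCNF f) θ ↔ ∀ c ∈ f, ∃ ℓ ∈ c, ℓ.eval θ = true := by
  simp [CNF.SatisfiedBy, Clause.SatisfiedBy, toCNF]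

theorem toCNF_mem_krom {f : List (List Literal)} :
    toCNF f ∈ krom ↔ ∀ c ∈ f, isKrom c = true := by
  simp [krom, toCNF, isKrom_iff]

/-- A conjunction follows iff each of its clauses does, and a clause follows iff its negation, a set
of unit clauses, contradicts the premises. Unit clauses are Krom, so `unsat_iff` applies. -/
theorem decideInstance_iff {p : List (List (List Literal))} {f : List (List Literal)} :
    decideInstance p f = true ↔
      (toPremises p : Set CNF) ⊆ krom ∧ toCNF f ∈ krom ∧ Entails (toPremises p) (toCNF f) := by
  have h1 : (toPremises p : Set CNF) ⊆ krom ↔ ∀ φ ∈ p, ∀ c ∈ φ, isKrom c = true := by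
    simp [toPremises, Set.subset_def, toCNF_mem_krom]
  rw [h1, toCNF_mem_krom]
  simp only [decideInstance, Bool.and_eq_true, List.all_eq_true, and_assoc]
  refine and_congr_right fun hp => and_congr_right fun hf => ?_
  have h2 : Entails (toPremises p) (toCNF f) ↔ ∀ c ∈ f, ∀ θ : Assignment,
      (∀ φ ∈ p, ∀ c ∈ φ, ∃ ℓ ∈ c, ℓ.eval θ = true) → ∃ ℓ ∈ c, ℓ.eval θ = true := by
    simp only [Entails, toPremises, List.mem_toFinset, List.mem_map, forall_exists_index, and_imp,
      forall_apply_eq_imp_iff₂, toCNF_satisfiedBy]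
    exact ⟨fun h c hc θ hθ => h θ hθ c hc, fun h θ hθ c hc => h c hc θ hθ⟩
  rw [h2]
  refine forall₂_congr fun c hc => ?_
  rw [unsat_iff]
  · refine forall_congr' fun θ => ?_
    simp only [List.mem_append, List.mem_flatten, List.mem_map]
    constructor
    · intro h hθ
      by_contra! hcon
      refine h ?_
      rintro d (⟨φ, hφ, hd⟩ | ⟨ℓ, hℓ, rfl⟩)
      · exact hθ φ hφ d hd
      · exact ⟨ℓ.neg, by simp, by simpa using hcon ℓ hℓ⟩
    · intro h hθ
      obtain ⟨ℓ, hℓ, hℓ'⟩ := h fun φ hφ d hd => hθ d (.inl ⟨φ, hφ, hd⟩)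
      obtain ⟨ℓ₂, h₂, h₂'⟩ := hθ [ℓ.neg] (.inr ⟨ℓ, hℓ, rfl⟩)
      rw [List.mem_singleton] at h₂
      subst h₂
      simp [hℓ'] at h₂'
  · intro d hd
    simp only [List.mem_append, List.mem_flatten, List.mem_map] at hd
    rcases hd with ⟨φ, hφ, hd⟩ | ⟨ℓ, -, rfl⟩
    · exact hp φ hφ d hd
    · simp [isKrom]

/-! Running time -/

namespace PolyTime

variable {α : Type} [TreeEnc α]

@[fun_prop]
theorem literal_neg {f : α → Literal} (hf : PolyTime f) : PolyTime fun a => (f a).neg := by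
  unfold Literal.neg
  fun_prop

@[fun_prop]
theorem implies {S : α → List (List Literal)} {f g : α → Literal} (hS : PolyTime S)
    (hf : PolyTime f) (hg : PolyTime g) : PolyTime fun a => implies (S a) (f a) (g a) := by
  unfold KromImp.implies
  refine any hS (and (by fun_prop) (all (by fun_prop) (by fun_prop)))

@[fun_prop]
theorem literals {S : α → List (List Literal)} (hS : PolyTime S) :
    PolyTime fun a => literals (S a) :=
  append (by fun_prop) (map (by fun_prop) (by fun_prop))

@[fun_prop]
theorem pairs {U : α → List Literal} (hU : PolyTime U) : PolyTime fun a => pairs (U a) :=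
  flatMap hU (map (by fun_prop) (by fun_prop))

theorem connect : PolyTime fun p : List Literal × List (Literal × Literal) × Literal =>
    connect p.1 p.2.1 p.2.2 :=
  filter (by fun_prop) (by fun_prop)

-- Every stage is a sublist of `pairs U`, so its size is bounded in terms of `U` alone, whatever the
-- previous stage; this is the growth condition of `foldl`.
@[fun_prop]
theorem implications : PolyTime implications := by
  obtain ⟨_, p, hp⟩ := pairs (id (α := List Literal))
  have h := foldl (γ := List Literal × List (Literal × Literal)) (l := fun c => c.1)
    (b := fun c => c.2) (f := fun c => KromImp.connect c.1) fst snd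
    (connect.comp (f := fun p : (List Literal × List (Literal × Literal)) ×
      List (Literal × Literal) × Literal => (p.1.1, p.2.1, p.2.2)) (by fun_prop)) p (fun c b k => by
      refine (size_le_of_sublist List.filter_sublist).trans (((hp c.1).1.trans
        (monotone_eval p ?_)).trans (Nat.le_add_left _ _))
      obtain ⟨c, d⟩ := c
      simp only [size_pair]
      omega)
  have h' : PolyTime fun S => (KromImp.literals S,
      (KromImp.pairs (KromImp.literals S)).filter fun p => KromImp.implies S p.1 p.2) :=
    prodMk (literals id) (filter (pairs (literals id)) (implies fst (by fun_prop) (by fun_prop)))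
  exact h.comp h'

@[fun_prop]
theorem unsat : PolyTime unsat := by
  unfold KromImp.unsat
  exact or (any id (by fun_prop)) (any (by fun_prop) (by fun_prop))

@[fun_prop]
theorem isKrom : PolyTime isKrom := by
  unfold KromImp.isKrom
  exact or (by fun_prop) (any id (any (by fun_prop) (all (by fun_prop) (by fun_prop))))

theorem decideInstance : PolyTime fun p : List (List (List Literal)) × List (List Literal) =>
    decideInstance p.1 p.2 := by
  unfold KromImp.decideInstance
  refine and (and (all fst (all (by fun_prop) (by fun_prop))) (all (by fun_prop) (by fun_prop)))
    (all (by fun_prop) (unsat.comp (append (by fun_prop) (map (by fun_prop) (by fun_prop)))))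

end PolyTime

end KromImp

namespace KromImp

open TreeEnc StkProg Polynomial

/-! ### Parsing the input word from right to left -/

/-- Apply a partial operation to the head of a list. -/
def onHead {α : Type} (g : α → Option α) : List α → Option (List α)
  | [] => none
  | a :: l => (g a).map (· :: l)

/-- A parser state: the conclusion, if the turnstile has been read, and the formulas read on the
current side of it. -/
abbrev ParseState : Type := Option (List (List Literal)) × List (List (List Literal))

/-- Extend the parsed part of the word by one symbol to the left. -/
def parseSymbol : Symbol → ParseState → Option ParseState
  | .endFormula, st => some (st.1, [] :: st.2)
  | .endClause, st => (onHead (fun φ => some ([] :: φ)) st.2).map (Prod.mk st.1)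
  | .pos, st => (onHead (onHead fun c => some (⟨[], true⟩ :: c)) st.2).map (Prod.mk st.1)
  | .neg, st => (onHead (onHead fun c => some (⟨[], false⟩ :: c)) st.2).map (Prod.mk st.1)
  | .bit b, st =>
    (onHead (onHead (onHead fun ℓ => some ⟨b :: ℓ.var, ℓ.positive⟩)) st.2).map (Prod.mk st.1)
  | .turnstile, (none, [φ]) => some (some φ, [])
  | .turnstile, _ => none

/-- Parse a word from right to left. -/
def parse (w : List Symbol) : Option ParseState :=
  w.foldr (fun s st => st.bind (parseSymbol s)) (some (none, []))

/-- The part of the word represented by a parser state. -/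
def ParseState.encode (st : ParseState) : List Symbol :=
  st.2.flatMap encodeFormula ++ st.1.elim [] fun φ => Symbol.turnstile :: encodeFormula φ

/-- This is the soundness of the parser: every symbol it accepts is accounted for in the state, so a
successful parse reproduces the whole word. Read from the right, end markers and signs open an item
before its contents appear. -/
theorem encode_of_parseSymbol {s : Symbol} {st st' : ParseState}
    (h : parseSymbol s st = some st') : st'.encode = s :: st.encode := by
  obtain ⟨o, d⟩ := st
  cases s with
  | turnstile =>
    rcases o with _ | o <;> rcases d with _ | ⟨φ, _ | ⟨φ', d⟩⟩ <;> simp [parseSymbol] at h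
    subst h
    simp [ParseState.encode]
  | _ =>
    rcases d with _ | ⟨_ | ⟨_ | ⟨ℓ, c⟩, φ⟩, d⟩ <;> simp [parseSymbol, onHead] at h <;> subst h <;>
      simp [ParseState.encode, encodeFormula, encodeClause, encodeLiteral]

theorem encode_of_parse {w : List Symbol} {st : ParseState} (h : parse w = some st) :
    st.encode = w := by
  induction w generalizing st with
  | nil =>
    cases h
    rfl
  | cons s w ih =>
    obtain ⟨st₀, h₀, h₁⟩ := Option.bind_eq_some_iff.1 (show (parse w).bind (parseSymbol s) = _ from h)
    rw [encode_of_parseSymbol h₁, ih h₀]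

section

variable (o : Option (List (List Literal))) (d : List (List (List Literal)))

theorem foldr_encodeLiteral (ℓ : Literal) (c φ) :
    (encodeLiteral ℓ).foldr (fun s st => st.bind (parseSymbol s)) (some (o, (c :: φ) :: d)) =
      some (o, ((ℓ :: c) :: φ) :: d) := by
  obtain ⟨v, p⟩ := ℓ
  induction v with
  | nil => cases p <;> simp [encodeLiteral, parseSymbol, onHead]
  | cons b v ih =>
    simp only [encodeLiteral, List.map_cons, List.cons_append, List.foldr_cons] at ih ⊢
    rw [ih]
    simp [parseSymbol, onHead]

theorem foldr_encodeClause (c : List Literal) (φ) :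
    (encodeClause c).foldr (fun s st => st.bind (parseSymbol s)) (some (o, φ :: d)) =
      some (o, (c :: φ) :: d) := by
  induction c with
  | nil => simp [encodeClause, parseSymbol, onHead]
  | cons ℓ c ih =>
    simp only [encodeClause, List.flatMap_cons, List.append_assoc, List.foldr_append] at ih ⊢
    rw [ih, foldr_encodeLiteral]

theorem foldr_encodeFormula (φ : List (List Literal)) :
    (encodeFormula φ).foldr (fun s st => st.bind (parseSymbol s)) (some (o, d)) =
      some (o, φ :: d) := by
  induction φ with
  | nil => simp [encodeFormula, parseSymbol]
  | cons c φ ih =>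
    simp only [encodeFormula, List.flatMap_cons, List.append_assoc, List.foldr_append] at ih ⊢
    rw [ih, foldr_encodeClause]

end

theorem parse_encodeInstance (p : List (List (List Literal))) (f : List (List Literal)) :
    parse (encodeInstance p f) = some (some f, p) := by
  rw [parse, encodeInstance, List.foldr_append, foldr_encodeFormula]
  induction p with
  | nil => simp [parseSymbol]
  | cons φ p ih =>
    rw [List.flatMap_cons, List.append_assoc, List.foldr_append, ih, foldr_encodeFormula]

/-- The decision procedure on parser states. -/
def decideParsed (st : Option ParseState) : Bool :=
  st.elim false fun st => st.1.elim false fun f => decideInstance st.2 f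

theorem decideParsed_iff {w : List Symbol} : decideParsed (parse w) = true ↔ w ∈ IMP krom := by
  constructor
  · intro h
    rcases hw : parse w with _ | ⟨_ | f, p⟩
    · simp [hw, decideParsed] at h
    · simp [hw, decideParsed] at h
    · rw [hw] at h
      obtain ⟨h1, h2, h3⟩ := decideInstance_iff.1 h
      refine ⟨_, _, ⟨p, f, rfl, rfl, ?_⟩, h1, h2, h3⟩
      rw [← encode_of_parse hw]
      simp [ParseState.encode, encodeInstance]
  · rintro ⟨_, _, ⟨p, f, rfl, rfl, rfl⟩, h1, h2, h3⟩
    rw [parse_encodeInstance]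
    exact decideInstance_iff.2 ⟨h1, h2, h3⟩

/-! Running time -/

section

variable {α β γ : Type} [TreeEnc α] [TreeEnc β] [TreeEnc γ]

@[simp] theorem size_some (a : α) : size (some a) = size a + 2 :=
  size_cons a []

@[simp] theorem size_none : size (none : Option α) = 1 := rfl

namespace PolyTime

/-- A program sees only codes, so it may be reused at another output type, as for `some b` and
`[b]`. -/
theorem congr_enc {f : α → β} {g : α → γ} (hf : PolyTime f) (h : ∀ a, enc (g a) = enc (f a)) :
    PolyTime g := by
  obtain ⟨c, p, hp⟩ := hf
  have h' : ∀ a, bits (g a) = bits (f a) := fun a => congrArg BTree.code (h a)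
  exact ⟨c, p, by simpa only [size, h'] using hp⟩

@[fun_prop]
theorem some {f : α → β} (hf : PolyTime f) : PolyTime fun a => Option.some (f a) :=
  congr_enc (hf.cons (const [])) fun _ => rfl

theorem option_cases {g : α → Option β} {h f₀ : α → γ} {f₁ : α × β → γ} (hg : PolyTime g)
    (h₀ : PolyTime f₀) (h₁ : PolyTime f₁) (e₀ : ∀ a, g a = none → h a = f₀ a)
    (e₁ : ∀ a b, g a = Option.some b → h a = f₁ (a, b)) : PolyTime h :=
  list_cases (g := fun a => (g a).toList) ((of_enc_eq fun _ => rfl).comp hg) h₀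
    (f₁ := fun p => f₁ (p.1, p.2.1)) (by fun_prop) (fun a ha => e₀ a (by simpa using ha))
    (fun a b l ha => e₁ a b (by cases hga : g a <;> simp_all))

theorem option_map {g : α → Option β} {f : α → β → γ} (hg : PolyTime g)
    (hf : PolyTime fun p : α × β => f p.1 p.2) : PolyTime fun a => (g a).map (f a) :=
  option_cases hg (const none) (some hf) (fun a h => by simp [h]) (fun a b h => by simp [h])

theorem onHead {g : α → Option α} (hg : PolyTime g) : PolyTime (onHead g) :=
  list_cases id (const none)
    (option_map (g := fun p : List α × α × List α => g p.2.1) (f := fun p b => b :: p.2.2)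
      (by fun_prop) (by fun_prop))
    (fun a h => by rw [h]; rfl) (fun a b l h => by rw [h]; rfl)

theorem parseSymbol (s : Symbol) : PolyTime (parseSymbol s) := by
  cases s with
  | turnstile =>
    have h₁ : PolyTime fun p : ParseState × List (List Literal) × List (List (List Literal)) =>
        if p.2.2.isEmpty then Option.some
          (Option.some p.2.1, ([] : List (List (List Literal)))) else none :=
      ite (by fun_prop) (by fun_prop) (const _)
    refine option_cases (g := fun st => st.1) (f₁ := fun _ => none) fst
      (list_cases (h := fun st => KromImp.parseSymbol .turnstile (none, st.2)) snd (const none) h₁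
        ?_ ?_) (const none) ?_ ?_
    · rintro ⟨o, d⟩ h
      cases h
      rfl
    · rintro ⟨o, d⟩ φ l h
      cases h
      cases l <;> rfl
    · rintro ⟨o, d⟩ h
      cases h
      rfl
    · rintro ⟨o, d⟩ φ h
      cases h
      rfl
  | endFormula =>
    unfold KromImp.parseSymbol
    fun_prop
  | _ =>
    unfold KromImp.parseSymbol
    refine option_map (comp ?_ snd) (by fun_prop)
    first
    | exact onHead (by fun_prop)
    | exact onHead (onHead (by fun_prop))
    | exact onHead (onHead (onHead (by fun_prop)))

theorem decideParsed : PolyTime decideParsed :=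
  option_cases (g := fun st => st) id (const false)
    (option_cases (g := fun p : Option ParseState × ParseState => p.2.1) (by fun_prop) (const false)
      (f₁ := fun p => KromImp.decideInstance p.1.2.2 p.2) (PolyTime.decideInstance.comp (f := fun p :
        (Option ParseState × ParseState) × List (List Literal) => (p.1.2.2, p.2)) (by fun_prop))
      (h := fun p => p.2.1.elim false fun f => KromImp.decideInstance p.2.2 f)
      (fun p h => by simp [h]) (fun p f h => by simp [h]))
    (fun st h => by rw [h]; rfl) (fun st p h => by rw [h]; rfl)

end PolyTime

/-! ### Linear growth of the parser state -/

theorem size_onHead_le {g : α → Option α} {n : ℕ} (hg : ∀ a, size (g a) ≤ size a + n)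
    (l : List α) : size (onHead g l) ≤ size l + n := by
  cases l with
  | nil => simp [onHead]
  | cons a l =>
    have := hg a
    cases h : g a with
    | none => simp [onHead, h]; omega
    | some b =>
      simp [onHead, h] at this ⊢
      omega

theorem size_map_prodMk_le {a : α} {b : β} {o : Option β} {n : ℕ} (h : size o ≤ size b + n) :
    size (o.map (Prod.mk a)) ≤ size (a, b) + n := by
  cases o with
  | none => simp; omega
  | some b => simp at h ⊢; omega

theorem size_literal (v : List Bool) (p : Bool) : size (Literal.mk v p) = size v + size p + 1 :=
  size_pair v p

/-- A symbol adds at most a bounded number of tree nodes; 20 is a generous bound. The growth is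
additive, so the state stays linear in the word. -/
theorem size_parseSymbol_le (s : Symbol) (st : ParseState) :
    size (parseSymbol s st) ≤ size st + 20 := by
  obtain ⟨o, d⟩ := st
  cases s with
  | turnstile =>
    rcases o with _ | o <;> rcases d with _ | ⟨φ, _ | ⟨φ', d⟩⟩ <;> simp [parseSymbol]
    omega
  | endFormula => simp [parseSymbol]; omega
  | endClause => exact size_map_prodMk_le (size_onHead_le (fun φ => by simp; omega) d)
  | pos | neg =>
    refine size_map_prodMk_le (size_onHead_le (size_onHead_le fun c => ?_) d)
    have := size_bool_le true
    have := size_bool_le false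
    simp [size_literal]
    omega
  | bit b =>
    refine size_map_prodMk_le (size_onHead_le (size_onHead_le (size_onHead_le fun ℓ => ?_)) d)
    have := size_bool_le b
    rw [show size ℓ = size (Literal.mk ℓ.var ℓ.positive) from rfl]
    simp [size_literal]
    omega

theorem size_bind_parseSymbol_le (s : Symbol) (st : Option ParseState) :
    size (st.bind (parseSymbol s)) ≤ size st + 20 := by
  cases st with
  | none => simp
  | some st =>
    have := size_parseSymbol_le s st
    rw [Option.bind_some, size_some]
    omega

theorem PolyTime.bind_parseSymbol (s : Symbol) :
    PolyTime fun st : Option ParseState => st.bind (KromImp.parseSymbol s) :=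
  option_cases id (const none) (f₁ := fun p => KromImp.parseSymbol s p.2)
    ((PolyTime.parseSymbol s).comp snd) (fun st h => by rw [h]; rfl) (fun st a h => by rw [h]; rfl)

end

/-! ### The Turing machine -/

/-- The input pops from its left end, while the parser needs the right end first. -/
theorem runs_reverse (w v : List Symbol) {m : List Bool} :
    Runs (.loop .inp fun s => .push .rev s) (contents w v [] m [] [] [])
      (conf (w.reverse ++ v) m) (2 * w.length + 1) := by
  induction w generalizing v with
  | nil => exact runs_loop_nil rfl
  | cons s w ih =>
    rw [List.reverse_cons, List.append_assoc]
    refine (runs_loop_cons rfl ?_ (ih (s :: v))).mono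
      (show 1 + (2 * w.length + 1) + 1 ≤ _ by simp only [List.length_cons]; omega)
    have := runs_push (S := contents w v [] m [] [] []) (k := .rev) s
    simpa using this

theorem runs_parse {c : Symbol → StkProg} {p : ℕ[X]}
    (hc : ∀ s (st : Option ParseState) v r, Runs (c s) (conf v (bits st ++ r))
      (conf v (bits (st.bind (parseSymbol s)) ++ r)) (p.eval (size st)))
    (w : List Symbol) (st : Option ParseState) {n : ℕ} (hn : size st + 20 * w.length ≤ n) :
    Runs (.loop .rev c) (conf w (bits st ++ []))
      (conf [] (bits (w.foldl (fun st s => st.bind (parseSymbol s)) st) ++ []))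
      ((w.length + 1) * (p.eval n + 1)) := by
  induction w generalizing st with
  | nil => exact (runs_loop_nil rfl).mono (by simp)
  | cons s w ih =>
    have h := size_bind_parseSymbol_le s st
    rw [List.length_cons] at hn
    have h' := hc s st w []
    refine (runs_loop_cons (k := Stk.rev) (l := w) rfl (by simpa using h')
      (ih (st.bind (parseSymbol s)) (by omega))).mono ?_
    have := monotone_eval p (show size st ≤ n by omega)
    simp only [List.length_cons, add_mul] at *
    omega

theorem size_foldl_parse_le (w : List Symbol) (st : Option ParseState) :
    size (w.foldl (fun st s => st.bind (parseSymbol s)) st) ≤ size st + 20 * w.length := by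
  induction w generalizing st with
  | nil => simp
  | cons s w ih =>
    have h1 := ih (st.bind (parseSymbol s))
    have h2 := size_bind_parseSymbol_le s st
    rw [List.foldl_cons, List.length_cons]
    omega

/-- Move the Boolean represented on the main stack to the output stack. -/
def outputBool : StkProg :=
  caseMain fun
    | some true => caseMain fun _ => caseMain fun _ => .push .out true
    | _ => .push .out false

theorem runs_outputBool (b : Bool) :
    Runs outputBool (conf [] (bits b ++ [])) (contents [] [] [b] [] [] [] []) 4 := by
  cases b with
  | false =>
    refine (runs_caseMain (b := false) (t := 1) ?_).mono (by omega)
    have := runs_push (S := conf [] []) (k := .out) false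
    simpa using this
  | true =>
    refine runs_caseMain (b := true) (runs_caseMain (b := false) (runs_caseMain (b := false)
      (t := 1) ?_))
    have := runs_push (S := conf [] []) (k := .out) true
    simpa using this

/-- Some structured program decides the implication problem in polynomial time. -/
theorem exists_program : ∃ (c : StkProg) (p : ℕ[X]), ∀ w : List Symbol,
    Runs c (contents w [] [] [] [] [] []) (contents [] [] [decideParsed (parse w)] [] [] [] [])
      (p.eval w.length) := by
  choose c p hc using PolyTime.bind_parseSymbol
  obtain ⟨d, q, hd⟩ := PolyTime.decideParsed
  let st₀ : Option ParseState := some (none, [])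
  refine ⟨.seq (pushAll (bits st₀)) (.seq (.loop .inp fun s => .push .rev s)
    (.seq (.loop .rev c) (.seq d outputBool))),
    2 * X + (X + 1) * ((∑ s, p s).comp (20 * X + C (size st₀)) + 1) +
      q.comp (20 * X + C (size st₀)) + C (size st₀ + 6), fun w => ?_⟩
  -- The sum over the finite alphabet is one polynomial dominating the bounds for all symbols.
  have hc' : ∀ s (st : Option ParseState) v r, Runs (c s) (conf v (bits st ++ r))
      (conf v (bits (st.bind (parseSymbol s)) ++ r)) ((∑ s, p s).eval (size st)) := by
    intro s st v r
    refine ((hc s st).2 v r).mono ?_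
    rw [eval_finsetSum]
    exact Finset.single_le_sum (f := fun s => (p s).eval (size st)) (fun _ _ => Nat.zero_le _)
      (Finset.mem_univ s)
  have h1 := runs_parse hc' w.reverse st₀ (n := 20 * w.length + size st₀)
    (by rw [List.length_reverse]; omega)
  have h2 := size_foldl_parse_le w.reverse st₀
  rw [List.foldl_reverse] at h1 h2
  rw [List.length_reverse] at h1 h2
  have h3 := (hd (parse w)).2 [] []
  have h4 := monotone_eval q (h2.trans_eq (Nat.add_comm _ _))
  have h5 := runs_reverse w [] (m := bits st₀ ++ [])
  rw [List.append_nil w.reverse] at h5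
  refine ((runs_pushAll (bits st₀)).seq (h5.seq (h1.seq (h3.seq (runs_outputBool _))))).mono ?_
  simp only [eval_add, eval_mul, eval_comp, eval_X, eval_C, eval_one, eval_ofNat]
  change size st₀ + 1 + _ ≤ _
  change q.eval (size (parse w)) ≤ q.eval (20 * w.length + size st₀) at h4
  omega

theorem inP_IMP_krom : InP (IMP krom) := by
  obtain ⟨c, p, hc⟩ := exists_program
  choose t ht hexec using hc
  refine ⟨{ tm := c.toFinTM2 .inp .out
            inputAlphabet := Equiv.refl _
            outputAlphabet := Equiv.refl _
            time := p + 1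
            outputsFun := fun w => { steps := t w + 1, evals_in_steps := ?_, steps_le_m := ?_ } }⟩
  · have h := (hexec w).steps_toFinTM2 (k₀ := .inp) (k₁ := .out)
    -- `InP` decides membership classically, so the computed Boolean is identified with that
    -- instance.
    have hw : decideParsed (parse w) = @decide (w ∈ IMP krom) (Classical.propDecidable _) := by
      rw [Bool.eq_iff_iff, decideParsed_iff]
      exact (@decide_eq_true_iff _ (_)).symm
    rw [hw] at h
    have hmap : List.map (Equiv.refl Symbol).invFun (_root_.id w) = w := List.map_id w
    have hin : ∀ w' : List Symbol, w' = w → Turing.initList (c.toFinTM2 .inp .out) w' =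
        ⟨some (some c.start), fun _ => none, contents w [] [] [] [] [] []⟩ := by
      rintro w rfl
      refine congrArg (Turing.TM2.Cfg.mk _ _) ?_
      funext k
      rcases k with _ | _ | _ | ⟨_ | _ | _ | _⟩ <;> rfl
    have hout : ∀ b : Bool, Turing.haltList (c.toFinTM2 .inp .out) [b] =
        ⟨none, fun _ => none, contents [] [] [b] [] [] [] []⟩ := by
      intro b
      refine congrArg (Turing.TM2.Cfg.mk _ _) ?_
      funext k
      rcases k with _ | _ | _ | ⟨_ | _ | _ | _⟩ <;> rfl
    rw [← hin _ hmap, ← hout] at h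
    exact h
  · simpa using ht w

end KromImp

theorem mainTheorem10 : KromImp.InP (KromImp.IMP KromImp.krom) := by
  exact KromImp.inP_IMP_krom
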